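/- Let $R$ be an associative unital ring, not necessarily commutative. An $R$-ring is an $R$-bimodule with an associative, $R$-balanced, $R$-bilinear multiplication (not necessarily with unity). An $R$-coring $(\mathcal C,\Delta,\varepsilon)$ is an $R$-bimodule with $R$-bilinear maps $\Delta:\mathcal C\to\mathcal C\otimes_R\mathcal C$, $\Delta(c)=\sum c_1\otimes c_2$, and $\varepsilon:\mathcal C\to R$ that are coassociative and counital. Its dual $R$-rings are ${}^*\mathcal C=\mathrm{Hom}_{R-}(\mathcal C,R)$ with $(f\star g)(c)=\sum g(c_1f(c_2))$, $(rf)(c)=f(cr)$, $(fr)(c)=f(c)r$, and $\mathcal C^*=\mathrm{Hom}_{-R}(\mathcal C,R)$ with $(f\star g)(c)=\sum f(g(c_1)c_2)$, $(rf)(c)=rf(c)$, $(fr)(c)=f(rc)$; both carry the finite topology, induced from the product topology on $R^{\mathcal C}$ with $R$ discrete. A measuring left $R$-pairing $P=(\mathcal A,\mathcal C)$ is an $R$-ring $\mathcal A$ and an $R$-coring $\mathcal C$ with an $R$-bilinear multiplicative map $\kappa_P:\mathcal A\to{}^*\mathcal C$, $\langle a,c\rangle:=\kappa_P(a)(c)$.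 A measuring right $R$-pairing $Q=(\mathcal B,\mathcal D)$ is defined likewise with $\kappa_Q:\mathcal B\to\mathcal D^*$. A module $W$ is locally projective if for every surjection $\pi:L\to N$, every $g:W\to N$ and every finitely generated submodule $F\subseteq W$ there is $g':W\to L$ with $\pi g'|_F=g|_F$. A $(\mathcal D,\mathcal C)$-bicomodule is an $R$-bimodule $M$ with coassociative $R$-bilinear coactions $M\to M\otimes_R\mathcal C$, $m\mapsto\sum m_{<0>}\otimes m_{<1>}$, and $M\to\mathcal D\otimes_RM$, $m\mapsto\sum m_{<-1>}\otimes m_{<0>}$, each colinear for the other; it is counital if both coactions are injective. Let ${}^{\mathcal D}\mathcal M^{\mathcal C}$ be the category of counital $(\mathcal D,\mathcal C)$-bicomodules and bicolinear maps. A $(\mathcal B,\mathcal A)$-bimodule is an $R$-bimodule $M$ with associative, $R$-balanced, $R$-bilinear actions of $\mathcal B$ on the left and $\mathcal A$ on the right that commute; its morphisms are the $R$-bilinear, $\mathcal B$-linear and $\mathcal A$-linear maps. It is faithful if $ma=0$ for all $a\in\mathcal A$ implies $m=0$, and $bm=0$ for all $b\in\mathcal B$ implies $m=0$; it is unital if $M\mathcal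 A=M$ and $\mathcal BM=M$. It is $(\mathcal D,\mathcal C)$-birational if for every $m\in M$ there are $\sum m_i\otimes c_i\in M\otimes_R\mathcal C$ with $ma=\sum m_i\langle a,c_i\rangle$ for all $a\in\mathcal A$, and $\sum d_j\otimes n_j\in\mathcal D\otimes_RM$ with $bm=\sum\langle b,d_j\rangle n_j$ for all $b\in\mathcal B$. Denote by ${}^{\mathcal D}\mathrm{Rat}^{\mathcal C}({}_{\mathcal B}\widetilde{\mathcal M}_{\mathcal A})$ and ${}^{\mathcal D}\mathrm{Rat}^{\mathcal C}({}_{\mathcal B}\mathcal M_{\mathcal A})$ the full subcategories of the faithful, respectively the unital, $(\mathcal D,\mathcal C)$-birational $(\mathcal B,\mathcal A)$-bimodules. Theorem. Let $P=(\mathcal A,\mathcal C)$ be a measuring left $R$-pairing and $Q=(\mathcal B,\mathcal D)$ a measuring right $R$-pairing ($\mathcal A$, $\mathcal B$ not necessarily with unities). Suppose that $\mathcal C$ is locally projective as a left $R$-module, $\mathcal D$ is locally projective as a right $R$-module, and $\kappa_P(\mathcal A)\subseteq{}^*\mathcal C$ and $\kappa_Q(\mathcal B)\subseteq\mathcal D^*$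 are dense in the finite topologies. Then there are isomorphisms (not merely equivalences) of categories $${}^{\mathcal D}\mathcal M^{\mathcal C}\;\simeq\;{}^{\mathcal D}\mathrm{Rat}^{\mathcal C}({}_{\mathcal B}\widetilde{\mathcal M}_{\mathcal A})={}^{\mathcal D}\mathrm{Rat}^{\mathcal C}({}_{\mathcal B}\mathcal M_{\mathcal A}),\qquad {}^{\mathcal D}\mathcal M^{\mathcal C}\;\simeq\;{}^{\mathcal D}\mathrm{Rat}^{\mathcal C}({}_{\mathcal D^*}\widetilde{\mathcal M}_{{}^*\mathcal C})={}^{\mathcal D}\mathrm{Rat}^{\mathcal C}({}_{\mathcal D^*}\mathcal M_{{}^*\mathcal C}),$$ where the isomorphisms are the identity on underlying $R$-bimodules and on maps, with actions $ma=\sum m_{<0>}\langle a,m_{<1>}\rangle$ and $bm=\sum\langle b,m_{<-1>}\rangle m_{<0>}$, and the second line uses the pairings $({}^*\mathcal C,\mathcal C)$ and $(\mathcal D^*,\mathcal D)$ given by evaluation. -/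

import Mathlib

open MulOpposite

universe u v w

/-! ## Modules and bimodules over a (noncommutative) ring

A left `R`-module is a `Module R`, a right `R`-module is a `Module Rᵐᵒᵖ`, with `m r` written
`op r • m`, and an `R`-bimodule carries both structures together with
`SMulCommClass R Rᵐᵒᵖ M`. Left `R`-linear maps are `M →ₗ[R] N`, right `R`-linear maps are
`M →ₗ[Rᵐᵒᵖ] N`. -/

/-- `R`-bilinear maps (that is, maps of `R`-bimodules). -/
structure BimodMap (R : Type*) [Ring R] (M N : Type*) [AddCommGroup M] [AddCommGroup N]
    [Module R M] [Module Rᵐᵒᵖ M] [Module R N] [Module Rᵐᵒᵖ N] extends M →ₗ[R] N where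
  map_op_smul' : ∀ (r : Rᵐᵒᵖ) (x : M), toFun (r • x) = r • toFun x

namespace BimodMap

variable {R M N L : Type*} [Ring R] [AddCommGroup M] [AddCommGroup N] [AddCommGroup L]
  [Module R M] [Module Rᵐᵒᵖ M] [Module R N] [Module Rᵐᵒᵖ N] [Module R L] [Module Rᵐᵒᵖ L]

instance : FunLike (BimodMap R M N) M N where
  coe f := f.toLinearMap
  coe_injective := by
    rintro ⟨f, hf⟩ ⟨g, hg⟩ h
    have h' : f = g := DFunLike.coe_injective h
    subst h'
    rfl

instance : AddMonoidHomClass (BimodMap R M N) M N where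
  map_add f := f.toLinearMap.map_add
  map_zero f := f.toLinearMap.map_zero

/-- The underlying left linear map. -/
abbrev left (f : BimodMap R M N) : M →ₗ[R] N := f.toLinearMap

/-- The underlying right linear map. -/
def right (f : BimodMap R M N) : M →ₗ[Rᵐᵒᵖ] N where
  toFun := f
  map_add' := f.toLinearMap.map_add
  map_smul' := f.map_op_smul'

@[simp] theorem left_apply (f : BimodMap R M N) (x : M) : f.left x = f x := rfl

@[simp] theorem right_apply (f : BimodMap R M N) (x : M) : f.right x = f x := rfl

@[simp] theorem map_smul_left (f : BimodMap R M N) (r : R) (x : M) : f (r • x) = r • f x :=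
  f.toLinearMap.map_smul r x

@[simp] theorem map_smul_right (f : BimodMap R M N) (r : Rᵐᵒᵖ) (x : M) :
    f (r • x) = r • f x :=
  f.map_op_smul' r x

@[ext] theorem ext {f g : BimodMap R M N} (h : ∀ x, f x = g x) : f = g :=
  DFunLike.ext _ _ h

/-- The identity. -/
def id (R M : Type*) [Ring R] [AddCommGroup M] [Module R M] [Module Rᵐᵒᵖ M] :
    BimodMap R M M where
  toLinearMap := LinearMap.id
  map_op_smul' _ _ := rfl

@[simp] theorem id_apply (x : M) : BimodMap.id R M x = x := rfl

/-- Composition. -/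
def comp (g : BimodMap R N L) (f : BimodMap R M N) : BimodMap R M L where
  toLinearMap := g.toLinearMap ∘ₗ f.toLinearMap
  map_op_smul' r x :=
    (congrArg g (f.map_op_smul' r x)).trans (g.map_op_smul' r (f x))

@[simp] theorem comp_apply (g : BimodMap R N L) (f : BimodMap R M N) (x : M) :
    g.comp f x = g (f x) := rfl

end BimodMap

/-! ## The tensor product over a noncommutative ring -/

open scoped TensorProduct in
/-- The subgroup of `M ⊗[ℤ] N` generated by the elements `(m r) ⊗ n - m ⊗ (r n)`. -/
def balancingSubgroup (R M N : Type*) [Ring R] [AddCommGroup M] [AddCommGroup N]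
    [Module Rᵐᵒᵖ M] [Module R N] : AddSubgroup (M ⊗[ℤ] N) :=
  AddSubgroup.closure
    {x | ∃ (m : M) (r : R) (n : N), x = (op r • m) ⊗ₜ[ℤ] n - m ⊗ₜ[ℤ] (r • n)}

open scoped TensorProduct in
/-- The tensor product `M ⊗_R N` of a right `R`-module `M` and a left `R`-module `N`. -/
def RTensor (R M N : Type*) [Ring R] [AddCommGroup M] [AddCommGroup N]
    [Module Rᵐᵒᵖ M] [Module R N] : Type _ :=
  (M ⊗[ℤ] N) ⧸ balancingSubgroup R M N

namespace RTensor

open scoped TensorProduct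

section basic

variable {R M N : Type*} [Ring R] [AddCommGroup M] [AddCommGroup N] [Module Rᵐᵒᵖ M] [Module R N]

instance : AddCommGroup (RTensor R M N) :=
  inferInstanceAs (AddCommGroup ((M ⊗[ℤ] N) ⧸ balancingSubgroup R M N))

variable (R) in
/-- The pure tensor `m ⊗ n`. -/
def tmul (m : M) (n : N) : RTensor R M N :=
  QuotientAddGroup.mk' (balancingSubgroup R M N) (m ⊗ₜ[ℤ] n)

theorem add_tmul (m m' : M) (n : N) : tmul R (m + m') n = tmul R m n + tmul R m' n := by
  simp only [tmul, TensorProduct.add_tmul, map_add]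
  rfl

theorem tmul_add (m : M) (n n' : N) : tmul R m (n + n') = tmul R m n + tmul R m n' := by
  simp only [tmul, TensorProduct.tmul_add, map_add]
  rfl

theorem smul_tmul (r : R) (m : M) (n : N) : tmul R (op r • m) n = tmul R m (r • n) := by
  refine (QuotientAddGroup.eq_iff_sub_mem).2 ?_
  exact AddSubgroup.subset_closure ⟨m, r, n, rfl⟩

theorem zero_tmul (n : N) : tmul R (0 : M) n = 0 := by
  have h := add_tmul (R := R) (0 : M) 0 n
  rw [add_zero] at h
  exact left_eq_add.mp h

theorem tmul_zero (m : M) : tmul R m (0 : N) = 0 := by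
  have h := tmul_add (R := R) m (0 : N) 0
  rw [add_zero] at h
  exact left_eq_add.mp h

@[elab_as_elim]
theorem induction_on {p : RTensor R M N → Prop} (x : RTensor R M N) (zero : p 0)
    (tmul : ∀ m n, p (tmul R m n)) (add : ∀ x y, p x → p y → p (x + y)) : p x := by
  obtain ⟨y, rfl⟩ := QuotientAddGroup.mk'_surjective (balancingSubgroup R M N) x
  induction y using TensorProduct.induction_on with
  | zero => exact zero
  | tmul m n => exact tmul m n
  | add y z hy hz => exact add _ _ hy hz

variable {P : Type*} [AddCommGroup P]

/-- The universal property: a biadditive balanced map `M × N → P` factors through `M ⊗_R N`. -/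
def lift (f : M →+ N →+ P) (hf : ∀ m (r : R) n, f (op r • m) n = f m (r • n)) :
    RTensor R M N →+ P :=
  QuotientAddGroup.lift (balancingSubgroup R M N)
    (TensorProduct.liftAddHom f (fun z m n => by simp)) (by
      refine (AddSubgroup.closure_le _).2 ?_
      rintro _ ⟨m, r, n, rfl⟩
      simp [hf, AddMonoidHom.mem_ker])

@[simp] theorem lift_tmul (f : M →+ N →+ P) (hf : ∀ m (r : R) n, f (op r • m) n = f m (r • n))
    (m : M) (n : N) : lift f hf (tmul R m n) = f m n := rfl

theorem hom_ext {f g : RTensor R M N →+ P} (h : ∀ m n, f (tmul R m n) = g (tmul R m n)) :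
    f = g := by
  ext x
  induction x using RTensor.induction_on with
  | zero => simp
  | tmul m n => exact h m n
  | add x y hx hy => simp [hx, hy]

/-- Pure tensors, as a biadditive map. -/
def mkHom (R M N : Type*) [Ring R] [AddCommGroup M] [AddCommGroup N] [Module Rᵐᵒᵖ M]
    [Module R N] : M →+ N →+ RTensor R M N :=
  AddMonoidHom.mk' (fun m => AddMonoidHom.mk' (fun n => tmul R m n) (tmul_add m))
    (fun m m' => by ext n; exact add_tmul m m' n)

@[simp] theorem mkHom_apply (m : M) (n : N) : mkHom R M N m n = tmul R m n := rfl

end basic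

section functoriality

variable {R M N M' N' : Type*} [Ring R] [AddCommGroup M] [AddCommGroup N] [Module Rᵐᵒᵖ M]
  [Module R N] [AddCommGroup M'] [AddCommGroup N'] [Module Rᵐᵒᵖ M'] [Module R N']

/-- `f ⊗ g`. -/
def map (f : M →ₗ[Rᵐᵒᵖ] M') (g : N →ₗ[R] N') : RTensor R M N →+ RTensor R M' N' :=
  lift (((mkHom R M' N').comp f.toAddMonoidHom).compl₂ g.toAddMonoidHom) (fun m r n => by
    simp [smul_tmul])

@[simp] theorem map_tmul (f : M →ₗ[Rᵐᵒᵖ] M') (g : N →ₗ[R] N') (m : M) (n : N) :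
    map f g (tmul R m n) = tmul R (f m) (g n) := rfl

end functoriality

section leftModule

variable {R M N : Type*} [Ring R] [AddCommGroup M] [AddCommGroup N] [Module R M]
  [Module Rᵐᵒᵖ M] [SMulCommClass R Rᵐᵒᵖ M] [Module R N]

/-- Left multiplication by `r` as a right linear map. -/
def lmulHom (r : R) : M →ₗ[Rᵐᵒᵖ] M where
  toFun m := r • m
  map_add' := smul_add r
  map_smul' s m := smul_comm r s m

instance : SMul R (RTensor R M N) := ⟨fun r => map (lmulHom r) LinearMap.id⟩

@[simp] theorem smul_tmul_left (r : R) (m : M) (n : N) :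
    r • tmul R m n = tmul R (r • m) n := rfl

/-- If `M` is a bimodule, `M ⊗_R N` is a left module through `r (m ⊗ n) = (r m) ⊗ n`. -/
instance : Module R (RTensor R M N) where
  smul_zero r := map_zero (map (lmulHom r) LinearMap.id)
  smul_add r := map_add (map (lmulHom r) LinearMap.id)
  one_smul x := by
    induction x using RTensor.induction_on with
    | zero => exact map_zero (map (lmulHom 1) LinearMap.id)
    | tmul m n => simp
    | add x y hx hy =>
      exact (map_add (map (lmulHom 1) LinearMap.id) x y).trans (congrArg₂ _ hx hy)
  mul_smul r s x := by
    have : map (lmulHom (r * s)) LinearMap.id = (map (lmulHom r) LinearMap.id).comp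
        (map (lmulHom s) LinearMap.id) (M := RTensor R M N) :=
      hom_ext fun m n => congrArg (fun m => tmul R m n) (mul_smul r s m)
    exact DFunLike.congr_fun this x
  add_smul r s x := by
    have : map (lmulHom (r + s)) LinearMap.id = map (lmulHom r) LinearMap.id +
        (map (lmulHom s) LinearMap.id : RTensor R M N →+ RTensor R M N) :=
      hom_ext fun m n => (congrArg (fun m => tmul R m n) (add_smul r s m)).trans
        (add_tmul _ _ n)
    exact DFunLike.congr_fun this x
  zero_smul x := by
    have : map (lmulHom 0) LinearMap.id = (0 : RTensor R M N →+ RTensor R M N) :=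
      hom_ext fun m n => (congrArg (fun m => tmul R m n) (zero_smul R m)).trans (zero_tmul n)
    exact DFunLike.congr_fun this x

end leftModule

section rightModule

variable {R M N : Type*} [Ring R] [AddCommGroup M] [AddCommGroup N] [Module Rᵐᵒᵖ M]
  [Module R N] [Module Rᵐᵒᵖ N] [SMulCommClass R Rᵐᵒᵖ N]

/-- Right multiplication as a left linear map. -/
def rmulHom (r : Rᵐᵒᵖ) : N →ₗ[R] N where
  toFun n := r • n
  map_add' := smul_add r
  map_smul' s n := (smul_comm s r n).symm

instance : SMul Rᵐᵒᵖ (RTensor R M N) := ⟨fun r => map LinearMap.id (rmulHom r)⟩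

@[simp] theorem smul_tmul_right (r : Rᵐᵒᵖ) (m : M) (n : N) :
    r • tmul R m n = tmul R m (r • n) := rfl

/-- If `N` is a bimodule, `M ⊗_R N` is a right module through `(m ⊗ n) r = m ⊗ (n r)`. -/
instance : Module Rᵐᵒᵖ (RTensor R M N) where
  smul_zero r := map_zero (map LinearMap.id (rmulHom r))
  smul_add r := map_add (map LinearMap.id (rmulHom r))
  one_smul x := by
    induction x using RTensor.induction_on with
    | zero => exact map_zero (map LinearMap.id (rmulHom 1))
    | tmul m n => simp
    | add x y hx hy =>
      exact (map_add (map LinearMap.id (rmulHom 1)) x y).trans (congrArg₂ _ hx hy)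
  mul_smul r s x := by
    have : map LinearMap.id (rmulHom (r * s)) = (map LinearMap.id (rmulHom r)).comp
        (map LinearMap.id (rmulHom s)) (M := RTensor R M N) :=
      hom_ext fun m n => congrArg (fun n => tmul R m n) (mul_smul r s n)
    exact DFunLike.congr_fun this x
  add_smul r s x := by
    have : map LinearMap.id (rmulHom (r + s)) = map LinearMap.id (rmulHom r) +
        (map LinearMap.id (rmulHom s) : RTensor R M N →+ RTensor R M N) :=
      hom_ext fun m n => (congrArg (fun n => tmul R m n) (add_smul r s n)).trans
        (tmul_add m _ _)
    exact DFunLike.congr_fun this x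
  zero_smul x := by
    have : map LinearMap.id (rmulHom 0) = (0 : RTensor R M N →+ RTensor R M N) :=
      hom_ext fun m n => (congrArg (fun n => tmul R m n) (zero_smul Rᵐᵒᵖ n)).trans (tmul_zero m)
    exact DFunLike.congr_fun this x

end rightModule

section bimodule

variable {R M N : Type*} [Ring R] [AddCommGroup M] [AddCommGroup N] [Module R M]
  [Module Rᵐᵒᵖ M] [SMulCommClass R Rᵐᵒᵖ M] [Module R N] [Module Rᵐᵒᵖ N] [SMulCommClass R Rᵐᵒᵖ N]

instance : SMulCommClass R Rᵐᵒᵖ (RTensor R M N) where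
  smul_comm r s x := by
    induction x using RTensor.induction_on with
    | zero => simp
    | tmul m n => simp
    | add x y hx hy => simp only [smul_add, hx, hy]

end bimodule

section canonicalMaps

variable {R : Type*} [Ring R]

/-- `n ↦ n ⊗ p`, a left linear map. -/
def tmulRight {N P : Type*} [AddCommGroup N] [AddCommGroup P] [Module R N] [Module Rᵐᵒᵖ N]
    [SMulCommClass R Rᵐᵒᵖ N] [Module R P] (p : P) : N →ₗ[R] RTensor R N P where
  toFun n := tmul R n p
  map_add' n n' := add_tmul n n' p
  map_smul' _ _ := rfl

/-- The associativity map `(M ⊗_R N) ⊗_R P → M ⊗_R (N ⊗_R P)`. -/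
def assoc (R M N P : Type*) [Ring R] [AddCommGroup M] [AddCommGroup N] [AddCommGroup P]
    [Module Rᵐᵒᵖ M] [Module R N] [Module Rᵐᵒᵖ N] [SMulCommClass R Rᵐᵒᵖ N] [Module R P] :
    RTensor R (RTensor R M N) P →+ RTensor R M (RTensor R N P) :=
  lift (AddMonoidHom.flip
      (AddMonoidHom.mk' (fun p => map LinearMap.id (tmulRight p)) (fun p p' =>
        hom_ext fun m n => (congrArg (tmul R m) (tmul_add n p p')).trans (tmul_add _ _ _))))
    (fun x r p => by
      induction x using RTensor.induction_on with
      | zero => rw [smul_zero, map_zero, AddMonoidHom.zero_apply, AddMonoidHom.zero_apply]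
      | tmul m n => exact congrArg (tmul R m) (smul_tmul r n p)
      | add x y hx hy => rw [smul_add, map_add, map_add, AddMonoidHom.add_apply,
          AddMonoidHom.add_apply, hx, hy])

@[simp] theorem assoc_tmul {M N P : Type*} [AddCommGroup M] [AddCommGroup N] [AddCommGroup P]
    [Module Rᵐᵒᵖ M] [Module R N] [Module Rᵐᵒᵖ N] [SMulCommClass R Rᵐᵒᵖ N] [Module R P]
    (m : M) (n : N) (p : P) :
    assoc R M N P (tmul R (tmul R m n) p) = tmul R m (tmul R n p) := rfl

/-- The canonical map `R ⊗_R N → N`. -/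
def lid (R N : Type*) [Ring R] [AddCommGroup N] [Module R N] : RTensor R R N →+ N :=
  lift (AddMonoidHom.mk' (fun r => AddMonoidHom.mk' (fun n => r • n) (smul_add r))
      (fun r s => by ext n; exact add_smul r s n))
    (fun r s n => by simp [mul_smul])

@[simp] theorem lid_tmul {N : Type*} [AddCommGroup N] [Module R N] (r : R) (n : N) :
    lid R N (tmul R r n) = r • n := rfl

/-- The canonical map `M ⊗_R R → M`. -/
def rid (R M : Type*) [Ring R] [AddCommGroup M] [Module Rᵐᵒᵖ M] : RTensor R M R →+ M :=
  lift (AddMonoidHom.mk' (fun m => AddMonoidHom.mk' (fun r : R => op r • m)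
        (fun r s => by rw [MulOpposite.op_add, add_smul]))
      (fun m m' => by ext r; exact smul_add (op r) m m'))
    (fun m s r => by simp [mul_smul])

@[simp] theorem rid_tmul {M : Type*} [AddCommGroup M] [Module Rᵐᵒᵖ M] (m : M) (r : R) :
    rid R M (tmul R m r) = op r • m := rfl

end canonicalMaps

end RTensor

/-! ## Corings and associative rings over `R` -/

/-- A coassociative and counital `R`-coring structure on the `R`-bimodule `C`. -/
class RCoring (R : Type*) (C : Type*) [Ring R] [AddCommGroup C] [Module R C] [Module Rᵐᵒᵖ C]
    [SMulCommClass R Rᵐᵒᵖ C] where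
  comul : BimodMap R C (RTensor R C C)
  counit : BimodMap R C R
  coassoc : ∀ c : C, RTensor.assoc R C C C (RTensor.map comul.right LinearMap.id (comul c)) =
    RTensor.map LinearMap.id comul.left (comul c)
  counit_left : ∀ c : C, RTensor.lid R C (RTensor.map counit.right LinearMap.id (comul c)) = c
  counit_right : ∀ c : C, RTensor.rid R C (RTensor.map LinearMap.id counit.left (comul c)) = c

/-- An associative `R`-ring, not necessarily with unity: an `R`-bimodule `A` with an associative
biadditive multiplication that is `R`-balanced and `R`-bilinear. -/
class IsRRing (R : Type*) (A : Type*) [Ring R] [NonUnitalRing A] [Module R A] [Module Rᵐᵒᵖ A] :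
    Prop extends SMulCommClass R Rᵐᵒᵖ A where
  smul_mul' : ∀ (r : R) (a b : A), (r • a) * b = r • (a * b)
  mul_op_smul' : ∀ (r : R) (a b : A), a * (op r • b) = op r • (a * b)
  op_smul_mul' : ∀ (r : R) (a b : A), (op r • a) * b = a * (r • b)

/-! ## The two duals of a bimodule -/

/-- `*U`, the left `R`-linear maps `U → R`. -/
def LeftDual (R U : Type*) [Ring R] [AddCommGroup U] [Module R U] : Type _ := U →ₗ[R] R

/-- `U*`, the right `R`-linear maps `U → R`. -/
def RightDual (R U : Type*) [Ring R] [AddCommGroup U] [Module Rᵐᵒᵖ U] : Type _ := U →ₗ[Rᵐᵒᵖ] R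

section duals

variable {R U : Type*} [Ring R] [AddCommGroup U]

namespace LeftDual

variable [Module R U]

instance : AddCommGroup (LeftDual R U) := inferInstanceAs (AddCommGroup (U →ₗ[R] R))

instance : FunLike (LeftDual R U) U R := inferInstanceAs (FunLike (U →ₗ[R] R) U R)

instance : LinearMapClass (LeftDual R U) R U R :=
  inferInstanceAs (LinearMapClass (U →ₗ[R] R) R U R)

@[ext] theorem ext {f g : LeftDual R U} (h : ∀ u, f u = g u) : f = g := DFunLike.ext _ _ h

@[simp] theorem add_apply (f g : LeftDual R U) (u : U) : (f + g) u = f u + g u := rfl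

@[simp] theorem zero_apply (u : U) : (0 : LeftDual R U) u = 0 := rfl

/-- `(f r)(u) = f(u) r`. -/
instance : Module Rᵐᵒᵖ (LeftDual R U) := inferInstanceAs (Module Rᵐᵒᵖ (U →ₗ[R] R))

@[simp] theorem op_smul_apply (r : R) (f : LeftDual R U) (u : U) : (op r • f) u = f u * r := rfl

variable [Module Rᵐᵒᵖ U] [SMulCommClass R Rᵐᵒᵖ U]

instance : SMul R (LeftDual R U) := ⟨fun r f => LinearMap.comp f (RTensor.rmulHom (op r))⟩

@[simp] theorem smul_apply (r : R) (f : LeftDual R U) (u : U) : (r • f) u = f (op r • u) := rfl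

/-- `(r f)(u) = f(u r)`. -/
instance : Module R (LeftDual R U) where
  smul_zero r := rfl
  smul_add r f g := rfl
  one_smul f := by ext u; simp
  mul_smul r s f := by ext u; simp [mul_smul]
  add_smul r s f := by ext u; simp [add_smul]
  zero_smul f := by ext u; simp

instance : SMulCommClass R Rᵐᵒᵖ (LeftDual R U) where
  smul_comm _ _ _ := rfl

end LeftDual

namespace RightDual

variable [Module Rᵐᵒᵖ U]

instance : AddCommGroup (RightDual R U) := inferInstanceAs (AddCommGroup (U →ₗ[Rᵐᵒᵖ] R))

instance : FunLike (RightDual R U) U R := inferInstanceAs (FunLike (U →ₗ[Rᵐᵒᵖ] R) U R)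

instance : LinearMapClass (RightDual R U) Rᵐᵒᵖ U R :=
  inferInstanceAs (LinearMapClass (U →ₗ[Rᵐᵒᵖ] R) Rᵐᵒᵖ U R)

@[ext] theorem ext {f g : RightDual R U} (h : ∀ u, f u = g u) : f = g := DFunLike.ext _ _ h

@[simp] theorem add_apply (f g : RightDual R U) (u : U) : (f + g) u = f u + g u := rfl

@[simp] theorem zero_apply (u : U) : (0 : RightDual R U) u = 0 := rfl

/-- `(r f)(u) = r f(u)`. -/
instance : Module R (RightDual R U) := inferInstanceAs (Module R (U →ₗ[Rᵐᵒᵖ] R))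

@[simp] theorem smul_apply (r : R) (f : RightDual R U) (u : U) : (r • f) u = r * f u := rfl

variable [Module R U] [SMulCommClass R Rᵐᵒᵖ U]

instance : SMul Rᵐᵒᵖ (RightDual R U) := ⟨fun r f => LinearMap.comp f (RTensor.lmulHom r.unop)⟩

@[simp] theorem op_smul_apply (r : R) (f : RightDual R U) (u : U) :
    (op r • f) u = f (r • u) := rfl

/-- `(f r)(u) = f(r u)`. -/
instance : Module Rᵐᵒᵖ (RightDual R U) where
  smul_zero r := rfl
  smul_add r f g := rfl
  one_smul f := by ext u; exact congrArg f (one_smul R u)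
  mul_smul r s f := by ext u; exact congrArg f (mul_smul s.unop r.unop u)
  add_smul r s f := by
    ext u; exact (congrArg f (add_smul r.unop s.unop u)).trans (map_add f _ _)
  zero_smul f := by ext u; exact (congrArg f (zero_smul R u)).trans (map_zero f)

instance : SMulCommClass R Rᵐᵒᵖ (RightDual R U) where
  smul_comm _ _ _ := rfl

end RightDual

/-- The finite topology on `*U`, induced by the product topology on `R^U` (`R` discrete). -/
@[reducible] def LeftDual.finiteTopology (R U : Type*) [Ring R] [AddCommGroup U] [Module R U] :
    TopologicalSpace (LeftDual R U) :=
  TopologicalSpace.induced (fun f => (f : U → R)) (@Pi.topologicalSpace U (fun _ => R) fun _ => ⊥)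

/-- The finite topology on `U*`, induced by the product topology on `R^U` (`R` discrete). -/
@[reducible] def RightDual.finiteTopology (R U : Type*) [Ring R] [AddCommGroup U] [Module Rᵐᵒᵖ U] :
    TopologicalSpace (RightDual R U) :=
  TopologicalSpace.induced (fun f => (f : U → R)) (@Pi.topologicalSpace U (fun _ => R) fun _ => ⊥)

end duals

/-! ## Evaluation of tensors at functionals -/

section evaluation

variable {R : Type*} [Ring R]

/-- `m ⊗ w ↦ m f(w)`, for a left linear functional `f`. -/
def LeftDual.eval {M W : Type*} [AddCommGroup M] [AddCommGroup W] [Module Rᵐᵒᵖ M] [Module R W]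
    (f : LeftDual R W) : RTensor R M W →+ M :=
  RTensor.lift (AddMonoidHom.mk' (fun m => AddMonoidHom.mk' (fun w => op (f w) • m)
        (fun w w' => by rw [map_add, MulOpposite.op_add, add_smul]))
      (fun m m' => by ext w; exact smul_add _ m m'))
    (fun m r w => by simp [mul_smul])

@[simp] theorem LeftDual.eval_tmul {M W : Type*} [AddCommGroup M] [AddCommGroup W]
    [Module Rᵐᵒᵖ M] [Module R W] (f : LeftDual R W) (m : M) (w : W) :
    f.eval (RTensor.tmul R m w) = op (f w) • m := rfl

/-- `w ⊗ m ↦ f(w) m`, for a right linear functional `f`. -/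
def RightDual.eval {M W : Type*} [AddCommGroup M] [AddCommGroup W] [Module R M] [Module Rᵐᵒᵖ W]
    (f : RightDual R W) : RTensor R W M →+ M :=
  RTensor.lift (AddMonoidHom.mk' (fun w => AddMonoidHom.mk' (fun m => f w • m)
        (fun m m' => smul_add _ m m'))
      (fun w w' => by
        ext m
        simp [map_add, add_smul]))
    (fun w r m => by simp [mul_smul])

@[simp] theorem RightDual.eval_tmul {M W : Type*} [AddCommGroup M] [AddCommGroup W]
    [Module R M] [Module Rᵐᵒᵖ W] (f : RightDual R W) (w : W) (m : M) :
    f.eval (RTensor.tmul R w m) = f w • m := rfl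

section linearity

variable {M W : Type*} [AddCommGroup M] [AddCommGroup W] [Module R M] [Module Rᵐᵒᵖ M]
  [SMulCommClass R Rᵐᵒᵖ M]

theorem LeftDual.eval_smul [Module R W] (f : LeftDual R W) (r : R) (x : RTensor R M W) :
    f.eval (r • x) = r • f.eval x := by
  induction x using RTensor.induction_on with
  | zero => simp
  | tmul m w => simp [smul_comm]
  | add x y hx hy => simp only [smul_add, map_add, hx, hy]

theorem RightDual.eval_op_smul [Module Rᵐᵒᵖ W] (f : RightDual R W) (r : R) (x : RTensor R W M) :
    f.eval (op r • x) = op r • f.eval x := by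
  induction x using RTensor.induction_on with
  | zero => simp
  | tmul w m => simp [smul_comm]
  | add x y hx hy => simp only [smul_add, map_add, hx, hy]

end linearity

theorem LeftDual.eval_op_smul {M W : Type*} [AddCommGroup M] [AddCommGroup W]
    [Module Rᵐᵒᵖ M] [Module R W] [Module Rᵐᵒᵖ W] [SMulCommClass R Rᵐᵒᵖ W]
    (f : LeftDual R W) (r : R) (x : RTensor R M W) :
    f.eval (op r • x) = (r • f).eval x := by
  induction x using RTensor.induction_on with
  | zero => simp
  | tmul m w => simp
  | add x y hx hy => simp only [smul_add, map_add, hx, hy]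

theorem RightDual.eval_smul {M W : Type*} [AddCommGroup M] [AddCommGroup W]
    [Module R M] [Module R W] [Module Rᵐᵒᵖ W] [SMulCommClass R Rᵐᵒᵖ W]
    (f : RightDual R W) (r : R) (x : RTensor R W M) :
    f.eval (r • x) = (op r • f).eval x := by
  induction x using RTensor.induction_on with
  | zero => simp
  | tmul m w => simp
  | add x y hx hy => simp only [smul_add, map_add, hx, hy]

theorem LeftDual.op_smul_eval {M W : Type*} [AddCommGroup M] [AddCommGroup W]
    [Module Rᵐᵒᵖ M] [Module R W] (f : LeftDual R W) (r : R) (x : RTensor R M W) :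
    op r • f.eval x = (op r • f).eval x := by
  induction x using RTensor.induction_on with
  | zero => simp
  | tmul m w => simp [mul_smul]
  | add x y hx hy => simp only [smul_add, map_add, hx, hy]

theorem RightDual.smul_eval {M W : Type*} [AddCommGroup M] [AddCommGroup W]
    [Module R M] [Module Rᵐᵒᵖ W] (f : RightDual R W) (r : R) (x : RTensor R W M) :
    r • f.eval x = (r • f).eval x := by
  induction x using RTensor.induction_on with
  | zero => simp
  | tmul m w => simp [mul_smul]
  | add x y hx hy => simp only [smul_add, map_add, hx, hy]

theorem LeftDual.add_eval {M W : Type*} [AddCommGroup M] [AddCommGroup W]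
    [Module Rᵐᵒᵖ M] [Module R W] (f g : LeftDual R W) (x : RTensor R M W) :
    (f + g).eval x = f.eval x + g.eval x := by
  induction x using RTensor.induction_on with
  | zero => simp
  | tmul m w => simp [add_smul]
  | add x y hx hy => simp only [map_add, hx, hy]; abel

theorem RightDual.add_eval {M W : Type*} [AddCommGroup M] [AddCommGroup W]
    [Module R M] [Module Rᵐᵒᵖ W] (f g : RightDual R W) (x : RTensor R W M) :
    (f + g).eval x = f.eval x + g.eval x := by
  induction x using RTensor.induction_on with
  | zero => simp
  | tmul m w => simp [add_smul]
  | add x y hx hy => simp only [map_add, hx, hy]; abel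

theorem LeftDual.eval_map {M N W : Type*} [AddCommGroup M] [AddCommGroup N] [AddCommGroup W]
    [Module Rᵐᵒᵖ M] [Module Rᵐᵒᵖ N] [Module R W] (f : LeftDual R W) (g : M →ₗ[Rᵐᵒᵖ] N)
    (x : RTensor R M W) : f.eval (RTensor.map g LinearMap.id x) = g (f.eval x) := by
  induction x using RTensor.induction_on with
  | zero => simp
  | tmul m w => simp
  | add x y hx hy => simp only [map_add, hx, hy]

theorem RightDual.eval_map {M N W : Type*} [AddCommGroup M] [AddCommGroup N] [AddCommGroup W]
    [Module R M] [Module R N] [Module Rᵐᵒᵖ W] (f : RightDual R W) (g : M →ₗ[R] N)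
    (x : RTensor R W M) : f.eval (RTensor.map LinearMap.id g x) = g (f.eval x) := by
  induction x using RTensor.induction_on with
  | zero => simp
  | tmul w m => simp
  | add x y hx hy => simp only [map_add, hx, hy]

end evaluation

/-! ## The dual rings of a coring -/

section dualRings

variable {R C : Type*} [Ring R] [AddCommGroup C] [Module R C] [Module Rᵐᵒᵖ C]
  [SMulCommClass R Rᵐᵒᵖ C] [RCoring R C]

namespace LeftDual

/-- `c ↦ ∑ c₁ f(c₂)`, a left linear map. -/
def act (f : LeftDual R C) : C →ₗ[R] C where
  toFun c := f.eval (RCoring.comul (R := R) c)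
  map_add' c d := by simp
  map_smul' r c := by simp [eval_smul]

theorem act_apply (f : LeftDual R C) (c : C) : f.act c = f.eval (RCoring.comul (R := R) c) := rfl

/-- The product `(f ⋆ g)(c) = ∑ g(c₁ f(c₂))` on `*C`. -/
instance : Mul (LeftDual R C) := ⟨fun f g => LinearMap.comp g f.act⟩

theorem mul_apply (f g : LeftDual R C) (c : C) :
    (f * g) c = g (f.eval (RCoring.comul (R := R) c)) := rfl

/-- A right coaction turns the product of `*C` into composition of actions. -/
theorem eval_eval {M : Type*} [AddCommGroup M] [Module Rᵐᵒᵖ M] (ρ : M →ₗ[Rᵐᵒᵖ] RTensor R M C)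
    (hρ : ∀ m, RTensor.assoc R M C C (RTensor.map ρ LinearMap.id (ρ m)) =
      RTensor.map LinearMap.id (RCoring.comul (R := R) (C := C)).left (ρ m))
    (f g : LeftDual R C) (m : M) :
    g.eval (ρ (f.eval (ρ m))) = (f * g).eval (ρ m) := by
  let T : RTensor R M (RTensor R C C) →+ M :=
    RTensor.lift (AddMonoidHom.mk' (fun m => AddMonoidHom.mk' (fun x => op (g (f.eval x)) • m)
        (fun w w' => by rw [map_add, map_add, MulOpposite.op_add, add_smul]))
      (fun m m' => by ext w; exact smul_add _ m m'))
      (fun m r w => by simp [eval_smul, mul_smul])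
  have h1 : ∀ x : RTensor R M C, T (RTensor.map LinearMap.id
      (RCoring.comul (R := R) (C := C)).left x) = (f * g).eval x := by
    intro x
    induction x using RTensor.induction_on with
    | zero => simp
    | tmul m c => rfl
    | add x y hx hy => simp only [map_add, hx, hy]
  have h2 : ∀ (y : RTensor R M C) (c : C),
      T (RTensor.assoc R M C C (RTensor.tmul R y c)) = g.eval (op (f c) • y) := by
    intro y c
    induction y using RTensor.induction_on with
    | zero => simp [RTensor.zero_tmul]
    | tmul m d => rfl
    | add x y hx hy => simp only [RTensor.add_tmul, map_add, smul_add, hx, hy]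
  have h3 : ∀ x : RTensor R M C, T (RTensor.assoc R M C C (RTensor.map ρ LinearMap.id x)) =
      g.eval (ρ (f.eval x)) := by
    intro x
    induction x using RTensor.induction_on with
    | zero => simp
    | tmul m c => simpa using h2 (ρ m) c
    | add x y hx hy => simp only [map_add, hx, hy]
  rw [← h3, ← h1, hρ]

/-- `*C` as an associative ring. -/
instance : NonUnitalRing (LeftDual R C) :=
  { (inferInstance : AddCommGroup (LeftDual R C)), (inferInstance : Mul (LeftDual R C)) with
    left_distrib := fun f g h => rfl
    right_distrib := fun f g h => by
      ext c
      simp [mul_apply, add_eval]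
    zero_mul := fun f => by
      ext c
      have h : (0 : LeftDual R C).eval (RCoring.comul (R := R) c) = 0 := by
        have := add_eval (0 : LeftDual R C) 0 (RCoring.comul (R := R) c)
        rw [add_zero] at this
        exact left_eq_add.mp this
      simp [mul_apply, h]
    mul_zero := fun f => rfl
    mul_assoc := fun f g h => by
      ext c
      rw [mul_apply, mul_apply, mul_apply]
      exact congrArg h (eval_eval RCoring.comul.right RCoring.coassoc f g c).symm }

instance : IsRRing R (LeftDual R C) where
  smul_mul' r f g := by
    ext c
    simp [mul_apply, eval_op_smul]
  mul_op_smul' r f g := rfl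
  op_smul_mul' r f g := by
    ext c
    simp [mul_apply, op_smul_eval]

end LeftDual

namespace RightDual

/-- `c ↦ ∑ f(c₁) c₂`, a right linear map. -/
def act (f : RightDual R C) : C →ₗ[Rᵐᵒᵖ] C where
  toFun c := f.eval (RCoring.comul (R := R) c)
  map_add' c d := by simp
  map_smul' r c := by
    have := eval_op_smul f r.unop (RCoring.comul (R := R) c)
    simpa using this

theorem act_apply (f : RightDual R C) (c : C) : f.act c = f.eval (RCoring.comul (R := R) c) := rfl

/-- The product `(f ⋆ g)(c) = ∑ f(g(c₁) c₂)` on `C*`. -/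
instance : Mul (RightDual R C) := ⟨fun f g => LinearMap.comp f g.act⟩

theorem mul_apply (f g : RightDual R C) (c : C) :
    (f * g) c = f (g.eval (RCoring.comul (R := R) c)) := rfl

/-- A left coaction turns the product of `C*` into composition of actions. -/
theorem eval_eval {M : Type*} [AddCommGroup M] [Module R M] (ρ : M →ₗ[R] RTensor R C M)
    (hρ : ∀ m, RTensor.assoc R C C M
        (RTensor.map (RCoring.comul (R := R) (C := C)).right LinearMap.id (ρ m)) =
      RTensor.map LinearMap.id ρ (ρ m))
    (f g : RightDual R C) (m : M) :
    f.eval (ρ (g.eval (ρ m))) = (f * g).eval (ρ m) := by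
  let S : RTensor R C (RTensor R C M) →+ M :=
    RTensor.lift (AddMonoidHom.mk' (fun c => f.eval.comp
        (AddMonoidHom.mk' (fun x : RTensor R C M => g c • x) (smul_add (g c))))
      (fun c c' => by ext x; simp [add_smul]))
      (fun c r x => by simp [mul_smul])
  have h1 : ∀ x : RTensor R C M, S (RTensor.map LinearMap.id ρ x) = f.eval (ρ (g.eval x)) := by
    intro x
    induction x using RTensor.induction_on with
    | zero => simp
    | tmul c m => simp [S]
    | add x y hx hy => simp only [map_add, hx, hy]
  have h2 : ∀ (y : RTensor R C C) (m : M),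
      S (RTensor.assoc R C C M (RTensor.tmul R y m)) = f (g.eval y) • m := by
    intro y m
    induction y using RTensor.induction_on with
    | zero => simp [RTensor.zero_tmul]
    | tmul c d => rfl
    | add x y hx hy => simp only [RTensor.add_tmul, map_add, add_smul, hx, hy]
  have h3 : ∀ x : RTensor R C M, S (RTensor.assoc R C C M
      (RTensor.map (RCoring.comul (R := R) (C := C)).right LinearMap.id x)) = (f * g).eval x := by
    intro x
    induction x using RTensor.induction_on with
    | zero => simp
    | tmul c m => exact h2 _ m
    | add x y hx hy => simp only [map_add, hx, hy]
  rw [← h1, ← h3, hρ]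

/-- `C*` as an associative ring. -/
instance : NonUnitalRing (RightDual R C) :=
  { (inferInstance : AddCommGroup (RightDual R C)), (inferInstance : Mul (RightDual R C)) with
    right_distrib := fun f g h => rfl
    left_distrib := fun f g h => by
      ext c
      simp [mul_apply, add_eval]
    mul_zero := fun f => by
      ext c
      have h : (0 : RightDual R C).eval (RCoring.comul (R := R) c) = 0 := by
        have := add_eval (0 : RightDual R C) 0 (RCoring.comul (R := R) c)
        rw [add_zero] at this
        exact left_eq_add.mp this
      simp [mul_apply, h]
    zero_mul := fun f => rfl
    mul_assoc := fun f g h => by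
      ext c
      rw [mul_apply, mul_apply, mul_apply]
      have := eval_eval (RCoring.comul (R := R) (C := C)).left RCoring.coassoc g h c
      simp only [BimodMap.left_apply] at this
      rw [this] }

instance : IsRRing R (RightDual R C) where
  smul_mul' r f g := rfl
  mul_op_smul' r f g := by
    ext c
    simp [mul_apply, eval_smul]
  op_smul_mul' r f g := by
    ext c
    simp [mul_apply, smul_eval]

end RightDual

end dualRings

/-! ## Measuring pairings -/

/-- A measuring left `R`-pairing `(A, C)`: a morphism of `R`-rings `κ : A → *C`
(`A` not necessarily with unity). -/
structure MeasuringLeftPairing (R A C : Type*) [Ring R] [NonUnitalRing A] [Module R A]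
    [Module Rᵐᵒᵖ A] [IsRRing R A] [AddCommGroup C] [Module R C] [Module Rᵐᵒᵖ C]
    [SMulCommClass R Rᵐᵒᵖ C] [RCoring R C] where
  κ : BimodMap R A (LeftDual R C)
  map_mul : ∀ a b : A, κ (a * b) = κ a * κ b

/-- A measuring right `R`-pairing `(B, D)`: a morphism of `R`-rings `κ : B → D*`
(`B` not necessarily with unity). -/
structure MeasuringRightPairing (R B D : Type*) [Ring R] [NonUnitalRing B] [Module R B]
    [Module Rᵐᵒᵖ B] [IsRRing R B] [AddCommGroup D] [Module R D] [Module Rᵐᵒᵖ D]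
    [SMulCommClass R Rᵐᵒᵖ D] [RCoring R D] where
  κ : BimodMap R B (RightDual R D)
  map_mul : ∀ a b : B, κ (a * b) = κ a * κ b

/-- `κ(A)` is dense in `*C` for the finite topology. -/
def MeasuringLeftPairing.IsDense {R A C : Type*} [Ring R] [NonUnitalRing A] [Module R A]
    [Module Rᵐᵒᵖ A] [IsRRing R A] [AddCommGroup C] [Module R C] [Module Rᵐᵒᵖ C]
    [SMulCommClass R Rᵐᵒᵖ C] [RCoring R C] (P : MeasuringLeftPairing R A C) : Prop :=
  @Dense _ (LeftDual.finiteTopology R C) (Set.range P.κ)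

/-- `κ(B)` is dense in `D*` for the finite topology. -/
def MeasuringRightPairing.IsDense {R B D : Type*} [Ring R] [NonUnitalRing B] [Module R B]
    [Module Rᵐᵒᵖ B] [IsRRing R B] [AddCommGroup D] [Module R D] [Module Rᵐᵒᵖ D]
    [SMulCommClass R Rᵐᵒᵖ D] [RCoring R D] (Q : MeasuringRightPairing R B D) : Prop :=
  @Dense _ (RightDual.finiteTopology R D) (Set.range Q.κ)

/-- The measuring left pairing `(*C, C)`. -/
def LeftDual.pairing (R C : Type*) [Ring R] [AddCommGroup C] [Module R C] [Module Rᵐᵒᵖ C]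
    [SMulCommClass R Rᵐᵒᵖ C] [RCoring R C] : MeasuringLeftPairing R (LeftDual R C) C where
  κ := BimodMap.id R (LeftDual R C)
  map_mul _ _ := rfl

/-- The measuring right pairing `(D*, D)`. -/
def RightDual.pairing (R D : Type*) [Ring R] [AddCommGroup D] [Module R D] [Module Rᵐᵒᵖ D]
    [SMulCommClass R Rᵐᵒᵖ D] [RCoring R D] : MeasuringRightPairing R (RightDual R D) D where
  κ := BimodMap.id R (RightDual R D)
  map_mul _ _ := rfl

/-- A left `S`-module `W` is locally projective: for every surjection `π : L → N`, every
`g : W → N` and every finitely generated `F ⊆ W` there is `g' : W → L` such that `π ∘ g'` and `g`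
agree on `F`. (A right `R`-module is a left module over `Rᵐᵒᵖ`.) -/
def IsLocallyProjective (S : Type u) (W : Type w) [Ring S] [AddCommGroup W] [Module S W] : Prop :=
  ∀ (L N : Type (max u w)) [AddCommGroup L] [AddCommGroup N] [Module S L] [Module S N]
    (π : L →ₗ[S] N) (_ : Function.Surjective π) (g : W →ₗ[S] N) (F : Submodule S W) (_ : F.FG),
    ∃ g' : W →ₗ[S] L, ∀ x ∈ F, π (g' x) = g x

/-! ## The category of bicomodules -/

open CategoryTheory

/-- A bundled `R`-bimodule. -/
structure RBimodule (R : Type*) [Ring R] where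
  carrier : Type v
  [addCommGroup : AddCommGroup carrier]
  [moduleLeft : Module R carrier]
  [moduleRight : Module Rᵐᵒᵖ carrier]
  [smulComm : SMulCommClass R Rᵐᵒᵖ carrier]

attribute [instance] RBimodule.addCommGroup RBimodule.moduleLeft RBimodule.moduleRight
  RBimodule.smulComm

section bicomodules

variable (R D C : Type*) [Ring R]
  [AddCommGroup D] [Module R D] [Module Rᵐᵒᵖ D] [SMulCommClass R Rᵐᵒᵖ D] [RCoring R D]
  [AddCommGroup C] [Module R C] [Module Rᵐᵒᵖ C] [SMulCommClass R Rᵐᵒᵖ C] [RCoring R C]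

/-- A `(D, C)`-bicomodule: an `R`-bimodule with a right `C`-coaction and a left `D`-coaction, each
of them coassociative and colinear for the other (in particular, both are `R`-bilinear). -/
structure Bicomodule extends RBimodule.{v} R where
  rcoact : BimodMap R carrier (RTensor R carrier C)
  rcoassoc : ∀ m, RTensor.assoc R carrier C C (RTensor.map rcoact.right LinearMap.id (rcoact m)) =
    RTensor.map LinearMap.id (RCoring.comul (R := R) (C := C)).left (rcoact m)
  lcoact : BimodMap R carrier (RTensor R D carrier)
  lcoassoc : ∀ m, RTensor.assoc R D D carrier
      (RTensor.map (RCoring.comul (R := R) (C := D)).right LinearMap.id (lcoact m)) =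
    RTensor.map LinearMap.id lcoact.left (lcoact m)
  compat : ∀ m, RTensor.assoc R D carrier C (RTensor.map lcoact.right LinearMap.id (rcoact m)) =
    RTensor.map LinearMap.id rcoact.left (lcoact m)

variable {R D C}

/-- Bicolinear maps. -/
@[ext] structure Bicomodule.Hom (M N : Bicomodule.{v} R D C) where
  toMap : BimodMap R M.carrier N.carrier
  rcolinear : ∀ m, N.rcoact (toMap m) = RTensor.map toMap.right LinearMap.id (M.rcoact m)
  lcolinear : ∀ m, N.lcoact (toMap m) = RTensor.map LinearMap.id toMap.left (M.lcoact m)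

theorem RTensor.map_right_id {M N : Type*} [AddCommGroup M] [AddCommGroup N] [Module Rᵐᵒᵖ M]
    [Module R N] (x : RTensor R M N) :
    RTensor.map (LinearMap.id : M →ₗ[Rᵐᵒᵖ] M) (LinearMap.id : N →ₗ[R] N) x = x := by
  induction x using RTensor.induction_on with
  | zero => simp
  | tmul m n => rfl
  | add x y hx hy => simp only [map_add, hx, hy]

instance : Category (Bicomodule.{v} R D C) where
  Hom := Bicomodule.Hom
  id M :=
    { toMap := BimodMap.id R M.carrier
      rcolinear := fun m => (RTensor.map_right_id _).symm
      lcolinear := fun m => (RTensor.map_right_id _).symm }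
  comp {L M N} f g :=
    { toMap := g.toMap.comp f.toMap
      rcolinear := fun m => by
        rw [BimodMap.comp_apply, g.rcolinear, f.rcolinear]
        generalize L.rcoact m = x
        induction x using RTensor.induction_on with
        | zero => simp
        | tmul m n => rfl
        | add x y hx hy => simp only [map_add, hx, hy]
      lcolinear := fun m => by
        rw [BimodMap.comp_apply, g.lcolinear, f.lcolinear]
        generalize L.lcoact m = x
        induction x using RTensor.induction_on with
        | zero => simp
        | tmul m n => rfl
        | add x y hx hy => simp only [map_add, hx, hy] }

variable (R D C) in
/-- A bicomodule is counital if both coactions are injective. -/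
def Bicomodule.IsCounital : ObjectProperty (Bicomodule.{v} R D C) := fun M =>
  Function.Injective M.rcoact ∧ Function.Injective M.lcoact

end bicomodules

/-! ## The category of `(B, A)`-bimodules over `R`-rings -/

section bimodules

variable (R B A : Type*) [Ring R]
  [NonUnitalRing B] [Module R B] [Module Rᵐᵒᵖ B] [IsRRing R B]
  [NonUnitalRing A] [Module R A] [Module Rᵐᵒᵖ A] [IsRRing R A]

/-- A `(B, A)`-bimodule over (not necessarily unital) `R`-rings: an `R`-bimodule `M` with
associative `R`-balanced actions `B × M → M`, written `lact b m`, and `M × A → M`, written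
`ract m a`, each of which is `R`-bilinear, and which commute with each other. -/
structure RingBimodule extends RBimodule.{v} R where
  ract : carrier →+ A →+ carrier
  ract_mul : ∀ m a a', ract m (a * a') = ract (ract m a) a'
  ract_balanced : ∀ m (r : R) a, ract (op r • m) a = ract m (r • a)
  ract_op_smul : ∀ m (r : R) a, ract m (op r • a) = op r • ract m a
  ract_smul : ∀ m (r : R) a, ract (r • m) a = r • ract m a
  lact : B →+ carrier →+ carrier
  lact_mul : ∀ b b' m, lact (b * b') m = lact b (lact b' m)
  lact_balanced : ∀ b (r : R) m, lact (op r • b) m = lact b (r • m)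
  lact_smul : ∀ b (r : R) m, lact (r • b) m = r • lact b m
  lact_op_smul : ∀ b (r : R) m, lact b (op r • m) = op r • lact b m
  lact_ract : ∀ b m a, ract (lact b m) a = lact b (ract m a)

variable {R B A}

/-- `(B, A)`-bilinear maps. -/
@[ext] structure RingBimodule.Hom (M N : RingBimodule.{v} R B A) where
  toMap : BimodMap R M.carrier N.carrier
  map_ract : ∀ m a, toMap (M.ract m a) = N.ract (toMap m) a
  map_lact : ∀ b m, toMap (M.lact b m) = N.lact b (toMap m)

instance : Category (RingBimodule.{v} R B A) where
  Hom := RingBimodule.Hom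
  id M :=
    { toMap := BimodMap.id R M.carrier
      map_ract := fun _ _ => rfl
      map_lact := fun _ _ => rfl }
  comp f g :=
    { toMap := g.toMap.comp f.toMap
      map_ract := fun m a => by simp [f.map_ract, g.map_ract]
      map_lact := fun b m => by simp [f.map_lact, g.map_lact] }

variable (R B A) in
/-- `M` is `(B, A)`-faithful: `M → Hom(A, M)` and `M → Hom(B, M)` are injective. -/
def RingBimodule.IsFaithful : ObjectProperty (RingBimodule.{v} R B A) := fun M =>
  Function.Injective (fun (m : M.carrier) (a : A) => M.ract m a) ∧
    Function.Injective (fun (m : M.carrier) (b : B) => M.lact b m)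

variable (R B A) in
/-- `M` is unital: `M A = M` and `B M = M`. -/
def RingBimodule.IsUnital : ObjectProperty (RingBimodule.{v} R B A) := fun M =>
  AddSubgroup.closure {x : M.carrier | ∃ m a, x = M.ract m a} = ⊤ ∧
    AddSubgroup.closure {x : M.carrier | ∃ b m, x = M.lact b m} = ⊤

end bimodules

/-! ## Birational bimodules -/

section birational

variable {R A B C D : Type*} [Ring R]
  [NonUnitalRing A] [Module R A] [Module Rᵐᵒᵖ A] [IsRRing R A]
  [NonUnitalRing B] [Module R B] [Module Rᵐᵒᵖ B] [IsRRing R B]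
  [AddCommGroup C] [Module R C] [Module Rᵐᵒᵖ C] [SMulCommClass R Rᵐᵒᵖ C] [RCoring R C]
  [AddCommGroup D] [Module R D] [Module Rᵐᵒᵖ D] [SMulCommClass R Rᵐᵒᵖ D] [RCoring R D]
  (P : MeasuringLeftPairing R A C) (Q : MeasuringRightPairing R B D)

/-- The `C`-rational part of `M_A`: the `m` for which there is `∑ mᵢ ⊗ cᵢ` with
`m a = ∑ mᵢ ⟨a, cᵢ⟩` for all `a`. -/
def RingBimodule.rightRat (M : RingBimodule.{v} R B A) : Set M.carrier :=
  {m | ∃ t : RTensor R M.carrier C, ∀ a, M.ract m a = (P.κ a).eval t}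

/-- The `D`-rational part of `_B M`: the `m` for which there is `∑ dᵢ ⊗ mᵢ` with
`b m = ∑ ⟨b, dᵢ⟩ mᵢ` for all `b`. -/
def RingBimodule.leftRat (M : RingBimodule.{v} R B A) : Set M.carrier :=
  {m | ∃ t : RTensor R D M.carrier, ∀ b, M.lact b m = (Q.κ b).eval t}

/-- `M` is `(D, C)`-birational: `M` equals the intersection of its `D`-rational and its
`C`-rational part. -/
def RingBimodule.IsBirational : ObjectProperty (RingBimodule.{v} R B A) := fun M =>
  M.leftRat Q ∩ M.rightRat P = Set.univ

/-- The objects of the category of `(D, C)`-birational `(B, A)`-faithful `(B, A)`-bimodules. -/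
def RingBimodule.IsFaithfulBirational : ObjectProperty (RingBimodule.{v} R B A) :=
  RingBimodule.IsFaithful R B A ⊓ RingBimodule.IsBirational P Q

/-- The objects of the category of `(D, C)`-birational unital `(B, A)`-bimodules. Faithfulness is
not demanded here; an equality with `IsFaithfulBirational` says that a birational bimodule is
faithful if and only if it is unital. -/
def RingBimodule.IsUnitalBirational : ObjectProperty (RingBimodule.{v} R B A) :=
  RingBimodule.IsUnital R B A ⊓ RingBimodule.IsBirational P Q

/-- The `(B, A)`-bimodule induced by a bicomodule, with actions `m a = ∑ m₀ ⟨a, m₁⟩` and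
`b m = ∑ ⟨b, m₋₁⟩ m₀`. -/
def Bicomodule.toRingBimodule (M : Bicomodule.{v} R D C) : RingBimodule.{v} R B A where
  toRBimodule := M.toRBimodule
  ract := AddMonoidHom.mk' (fun m => AddMonoidHom.mk' (fun a => (P.κ a).eval (M.rcoact m))
      (fun a a' => by rw [map_add, LeftDual.add_eval]))
    (fun m m' => by ext a; simp)
  ract_mul m a a' := by
    have := LeftDual.eval_eval M.rcoact.right M.rcoassoc (P.κ a) (P.κ a') m
    simpa [P.map_mul] using this.symm
  ract_balanced m r a := by simp [LeftDual.eval_op_smul]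
  ract_op_smul m r a := by simp [LeftDual.op_smul_eval]
  ract_smul m r a := by simp [LeftDual.eval_smul]
  lact := AddMonoidHom.mk' (fun b => (Q.κ b).eval.comp M.lcoact.left.toAddMonoidHom)
    (fun b b' => by ext m; simp [RightDual.add_eval])
  lact_mul b b' m := by
    have := RightDual.eval_eval M.lcoact.left M.lcoassoc (Q.κ b) (Q.κ b') m
    simpa [Q.map_mul] using this.symm
  lact_balanced b r m := by simp [RightDual.eval_smul]
  lact_smul b r m := by simp [RightDual.smul_eval]
  lact_op_smul b r m := by simp [RightDual.eval_op_smul]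
  lact_ract b m a := by
    have h1 : ∀ x : RTensor R M.carrier C, (P.κ a).eval ((Q.κ b).eval
        (RTensor.assoc R D M.carrier C (RTensor.map M.lcoact.right LinearMap.id x))) =
        (Q.κ b).eval (M.lcoact ((P.κ a).eval x)) := by
      intro x
      induction x using RTensor.induction_on with
      | zero => simp
      | tmul m c =>
        simp only [RTensor.map_tmul, BimodMap.right_apply, LinearMap.id_apply,
          LeftDual.eval_tmul, BimodMap.map_smul_right, RightDual.eval_op_smul]
        generalize M.lcoact m = y
        induction y using RTensor.induction_on with
        | zero => simp [RTensor.zero_tmul]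
        | tmul d n => simp
        | add x y hx hy => simp only [RTensor.add_tmul, map_add, smul_add, hx, hy]
      | add x y hx hy => simp only [map_add, hx, hy]
    have h2 := h1 (M.rcoact m)
    rw [M.compat, RightDual.eval_map] at h2
    exact h2

/-- The functor `M ↦ (M, induced actions)`, the identity on underlying maps. -/
def Bicomodule.toRingBimoduleFunctor :
    Bicomodule.{v} R D C ⥤ RingBimodule.{v} R B A where
  obj M := M.toRingBimodule P Q
  map {M N} f :=
    { toMap := f.toMap
      map_ract := fun m a => by
        exact ((congrArg (P.κ a).eval (f.rcolinear m)).trans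
          (LeftDual.eval_map (P.κ a) f.toMap.right (M.rcoact m))).symm
      map_lact := fun b m => by
        exact ((congrArg (Q.κ b).eval (f.lcolinear m)).trans
          (RightDual.eval_map (Q.κ b) f.toMap.left (M.lcoact m))).symm }

end birational

/-!
The idea is to replace local projectivity and density by one condition: `κ_P(A)` contains *local
dual bases* of `C`, that is, for finitely many `c` there are `wᵢ ∈ C` and `aᵢ ∈ A` with
`c = ∑ ⟨aᵢ, c⟩ wᵢ`. It follows that every `t ∈ M ⊗_R C` has the form `∑ ⟨aᵢ, t⟩ ⊗ wᵢ`, so a tensor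
is determined by its evaluations at the elements of `A`. The tensors that witness rationality of a
bimodule are then unique, which makes them into coactions: linearity, coassociativity and
compatibility can be tested by evaluation, where they become the laws of a bimodule. The same
test shows that bicolinear maps are the bilinear ones.

A coaction `ρ` satisfies `⟨a, ρ ⟨ε, ρ m⟩⟩ = ⟨ε a, ρ m⟩ = ⟨a, ρ m⟩`, so `ρ` is injective if and only
if `⟨ε, ρ m⟩ = m` for all `m`. That is in turn equivalent to `M A = M`: on the one hand
`⟨ε, ρ (m a)⟩ = m (a ε) = m a`, on the other `⟨ε, ∑ ⟨aᵢ, t⟩ ⊗ wᵢ⟩ = ∑ ⟨aᵢ ε(wᵢ), t⟩`.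
-/

/-! ### Iterated tensor products -/

namespace RTensor

variable {R M N P : Type*} [Ring R] [AddCommGroup M] [AddCommGroup N] [AddCommGroup P]
  [Module Rᵐᵒᵖ M] [Module R N] [Module Rᵐᵒᵖ N] [SMulCommClass R Rᵐᵒᵖ N] [Module R P]

theorem hom_ext₃ {L : Type*} [AddCommGroup L] {f g : RTensor R (RTensor R M N) P →+ L}
    (h : ∀ m n p, f (tmul R (tmul R m n) p) = g (tmul R (tmul R m n) p)) : f = g := by
  refine hom_ext fun x p => ?_
  have hp : f.comp ((mkHom R _ P).flip p) = g.comp ((mkHom R _ P).flip p) :=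
    hom_ext fun m n => h m n p
  exact DFunLike.congr_fun hp x

theorem assoc_surjective : Function.Surjective (assoc R M N P) := by
  intro t
  induction t using RTensor.induction_on with
  | zero => exact ⟨0, map_zero _⟩
  | tmul m x =>
    induction x using RTensor.induction_on with
    | zero => exact ⟨0, by rw [map_zero, tmul_zero]⟩
    | tmul n p => exact ⟨tmul R (tmul R m n) p, rfl⟩
    | add x y hx hy =>
      obtain ⟨x', hx'⟩ := hx
      obtain ⟨y', hy'⟩ := hy
      exact ⟨x' + y', by rw [map_add, hx', hy', tmul_add]⟩
  | add x y hx hy =>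
    obtain ⟨x', rfl⟩ := hx
    obtain ⟨y', rfl⟩ := hy
    exact ⟨x' + y', map_add _ _ _⟩

end RTensor

section functionals

variable {R M U W : Type*} [Ring R] [AddCommGroup M] [AddCommGroup U] [AddCommGroup W]

/-- The functional `u ⊗ w ↦ g(u f(w))` on `U ⊗_R W`. On `C ⊗_R C` it restricts along the
comultiplication to the product `f ⋆ g` of `*C`, whence the order of the arguments. -/
def LeftDual.tensor [Module R U] [Module Rᵐᵒᵖ U] [SMulCommClass R Rᵐᵒᵖ U] [Module R W]
    (f : LeftDual R W) (g : LeftDual R U) : LeftDual R (RTensor R U W) where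
  toFun x := g (f.eval x)
  map_add' x y := by rw [map_add, map_add]
  map_smul' r x := by rw [LeftDual.eval_smul, map_smul, RingHom.id_apply]

/-- The functional `w ⊗ u ↦ f(g(w) u)` on `W ⊗_R U`. On `D ⊗_R D` it restricts along the
comultiplication to the product `f ⋆ g` of `D*`, whence the order of the arguments. -/
def RightDual.tensor [Module R U] [Module Rᵐᵒᵖ U] [SMulCommClass R Rᵐᵒᵖ U] [Module Rᵐᵒᵖ W]
    (f : RightDual R U) (g : RightDual R W) : RightDual R (RTensor R W U) where
  toFun x := f (g.eval x)
  map_add' x y := by rw [map_add, map_add]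
  map_smul' r x := by
    rw [← op_unop r, RightDual.eval_op_smul, map_smul, RingHom.id_apply]

theorem LeftDual.tensor_eval_assoc [Module Rᵐᵒᵖ M] [Module R U] [Module Rᵐᵒᵖ U]
    [SMulCommClass R Rᵐᵒᵖ U] [Module R W] (f : LeftDual R W) (g : LeftDual R U)
    (z : RTensor R (RTensor R M U) W) :
    (f.tensor g).eval (RTensor.assoc R M U W z) = g.eval (f.eval z) := by
  have h : (f.tensor g).eval.comp (RTensor.assoc R M U W) = g.eval.comp f.eval :=
    RTensor.hom_ext₃ fun _ _ _ => rfl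
  exact DFunLike.congr_fun h z

theorem RightDual.eval_eval_assoc [Module R M] [Module R U] [Module Rᵐᵒᵖ U]
    [SMulCommClass R Rᵐᵒᵖ U] [Module Rᵐᵒᵖ W] (f : RightDual R U) (g : RightDual R W)
    (z : RTensor R (RTensor R W U) M) :
    f.eval (g.eval (RTensor.assoc R W U M z)) = (f.tensor g).eval z := by
  have h : f.eval.comp (g.eval.comp (RTensor.assoc R W U M)) = (f.tensor g).eval :=
    RTensor.hom_ext₃ fun _ _ _ => rfl
  exact DFunLike.congr_fun h z

theorem LeftDual.eval_rightDual_eval_assoc [Module R M] [Module Rᵐᵒᵖ M] [SMulCommClass R Rᵐᵒᵖ M]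
    [Module R U] [Module Rᵐᵒᵖ W] (f : LeftDual R U) (g : RightDual R W)
    (z : RTensor R (RTensor R W M) U) :
    f.eval (g.eval (RTensor.assoc R W M U z)) = g.eval (f.eval z) := by
  have h : f.eval.comp (g.eval.comp (RTensor.assoc R W M U)) = g.eval.comp f.eval :=
    RTensor.hom_ext₃ fun w m u => (smul_comm (g w) (op (f u)) m).symm
  exact DFunLike.congr_fun h z

end functionals

/-! ### Counit and comultiplication in the dual rings -/

section dualRings

variable {R M C : Type*} [Ring R] [AddCommGroup M] [AddCommGroup C] [Module R C] [Module Rᵐᵒᵖ C]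
  [SMulCommClass R Rᵐᵒᵖ C] [RCoring R C]

theorem LeftDual.tensor_eval_map_comul [Module Rᵐᵒᵖ M] (f g : LeftDual R C) (t : RTensor R M C) :
    (f.tensor g).eval (RTensor.map LinearMap.id (RCoring.comul (R := R) (C := C)).left t) =
      (f * g).eval t := by
  have h : (f.tensor g).eval.comp (RTensor.map LinearMap.id
      (RCoring.comul (R := R) (C := C)).left) = ((f * g).eval : RTensor R M C →+ M) :=
    RTensor.hom_ext fun _ _ => rfl
  exact DFunLike.congr_fun h t

theorem RightDual.tensor_eval_map_comul [Module R M] (f g : RightDual R C) (t : RTensor R C M) :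
    (f.tensor g).eval (RTensor.map (RCoring.comul (R := R) (C := C)).right LinearMap.id t) =
      (f * g).eval t := by
  have h : (f.tensor g).eval.comp (RTensor.map (RCoring.comul (R := R) (C := C)).right
      LinearMap.id) = ((f * g).eval : RTensor R C M →+ M) :=
    RTensor.hom_ext fun _ _ => rfl
  exact DFunLike.congr_fun h t

variable (R C) in
/-- The counit as an element of the ring `*C`, of which it is the unity. -/
def LeftDual.counit : LeftDual R C := (RCoring.counit (R := R) (C := C)).left

variable (R C) in
/-- The counit as an element of the ring `C*`, of which it is the unity. -/
def RightDual.counit : RightDual R C := (RCoring.counit (R := R) (C := C)).right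

theorem LeftDual.counit_eval_comul (c : C) :
    (LeftDual.counit R C).eval (RCoring.comul (R := R) c) = c := by
  have h : (LeftDual.counit R C).eval =
      (RTensor.rid R C).comp (RTensor.map LinearMap.id (RCoring.counit (R := R) (C := C)).left) :=
    RTensor.hom_ext fun _ _ => rfl
  rw [h]
  exact RCoring.counit_right c

theorem RightDual.counit_eval_comul (c : C) :
    (RightDual.counit R C).eval (RCoring.comul (R := R) c) = c := by
  have h : (RightDual.counit R C).eval =
      (RTensor.lid R C).comp (RTensor.map (RCoring.counit (R := R) (C := C)).right LinearMap.id) :=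
    RTensor.hom_ext fun _ _ => rfl
  rw [h]
  exact RCoring.counit_left c

theorem LeftDual.counit_eval_eq (f : LeftDual R C) (t : RTensor R C C) :
    LeftDual.counit R C (f.eval t) = f ((RightDual.counit R C).eval t) := by
  have h : (AddMonoidHomClass.toAddMonoidHom (LeftDual.counit R C)).comp f.eval =
      (AddMonoidHomClass.toAddMonoidHom f).comp (RightDual.counit R C).eval :=
    RTensor.hom_ext fun c d => calc
      RCoring.counit (R := R) (op (f d) • c) = RCoring.counit (R := R) c * f d :=
        BimodMap.map_smul_right _ _ c
      _ = f (RCoring.counit (R := R) c • d) := (map_smul f _ d).symm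
  exact DFunLike.congr_fun h t

theorem RightDual.counit_eval_eq (f : RightDual R C) (t : RTensor R C C) :
    RightDual.counit R C (f.eval t) = f ((LeftDual.counit R C).eval t) := by
  have h : (AddMonoidHomClass.toAddMonoidHom (RightDual.counit R C)).comp f.eval =
      (AddMonoidHomClass.toAddMonoidHom f).comp (LeftDual.counit R C).eval :=
    RTensor.hom_ext fun c d => calc
      RCoring.counit (R := R) (f c • d) = f c * RCoring.counit (R := R) d :=
        BimodMap.map_smul_left _ _ d
      _ = f (op (RCoring.counit (R := R) d) • c) := (map_smul f _ c).symm
  exact DFunLike.congr_fun h t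

theorem LeftDual.counit_mul (f : LeftDual R C) : LeftDual.counit R C * f = f := by
  ext c
  rw [LeftDual.mul_apply, LeftDual.counit_eval_comul]

theorem LeftDual.mul_counit (f : LeftDual R C) : f * LeftDual.counit R C = f := by
  ext c
  rw [LeftDual.mul_apply, LeftDual.counit_eval_eq, RightDual.counit_eval_comul]

theorem RightDual.mul_counit (f : RightDual R C) : f * RightDual.counit R C = f := by
  ext c
  rw [RightDual.mul_apply, RightDual.counit_eval_comul]

theorem RightDual.counit_mul (f : RightDual R C) : RightDual.counit R C * f = f := by
  ext c
  rw [RightDual.mul_apply, RightDual.counit_eval_eq, LeftDual.counit_eval_comul]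

end dualRings

/-! ### Local dual bases -/

theorem LeftDual.exists_finset_sum_eval_tmul {R M W : Type*} [Ring R] [AddCommGroup M]
    [AddCommGroup W] [Module Rᵐᵒᵖ M] [Module R W] (t : RTensor R M W) :
    ∃ F : Finset W, ∀ (T : Finset W) (f : W → LeftDual R W),
      (∀ x ∈ F, ∑ w ∈ T, f w x • w = x) → ∑ w ∈ T, RTensor.tmul R ((f w).eval t) w = t := by
  classical
  induction t using RTensor.induction_on with
  | zero =>
    exact ⟨∅, fun T f _ => by simp only [map_zero, RTensor.zero_tmul, Finset.sum_const_zero]⟩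
  | tmul m x =>
    refine ⟨{x}, fun T f hf => ?_⟩
    simp only [LeftDual.eval_tmul, RTensor.smul_tmul]
    exact (map_sum (RTensor.mkHom R M W m) _ T).symm.trans
      (congrArg (RTensor.tmul R m) (hf x (Finset.mem_singleton_self x)))
  | add s t hs ht =>
    obtain ⟨F, hF⟩ := hs
    obtain ⟨G, hG⟩ := ht
    refine ⟨F ∪ G, fun T f hf => ?_⟩
    simp only [map_add, RTensor.add_tmul, Finset.sum_add_distrib]
    rw [hF T f fun x hx => hf x (Finset.mem_union_left G hx),
      hG T f fun x hx => hf x (Finset.mem_union_right F hx)]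

theorem RightDual.exists_finset_sum_tmul_eval {R M W : Type*} [Ring R] [AddCommGroup M]
    [AddCommGroup W] [Module R M] [Module Rᵐᵒᵖ W] (t : RTensor R W M) :
    ∃ F : Finset W, ∀ (T : Finset W) (f : W → RightDual R W),
      (∀ x ∈ F, ∑ w ∈ T, op (f w x) • w = x) → ∑ w ∈ T, RTensor.tmul R w ((f w).eval t) = t := by
  classical
  induction t using RTensor.induction_on with
  | zero =>
    exact ⟨∅, fun T f _ => by simp only [map_zero, RTensor.tmul_zero, Finset.sum_const_zero]⟩
  | tmul x m =>
    refine ⟨{x}, fun T f hf => ?_⟩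
    simp only [RightDual.eval_tmul, ← RTensor.smul_tmul]
    exact (map_sum ((RTensor.mkHom R W M).flip m) _ T).symm.trans
      (congrArg (fun y => RTensor.tmul R y m) (hf x (Finset.mem_singleton_self x)))
  | add s t hs ht =>
    obtain ⟨F, hF⟩ := hs
    obtain ⟨G, hG⟩ := ht
    refine ⟨F ∪ G, fun T f hf => ?_⟩
    simp only [map_add, RTensor.tmul_add, Finset.sum_add_distrib]
    rw [hF T f fun x hx => hf x (Finset.mem_union_left G hx),
      hG T f fun x hx => hf x (Finset.mem_union_right F hx)]

theorem IsLocallyProjective.exists_localDualBasis {S : Type u} {W : Type w} [Ring S]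
    [AddCommGroup W] [Module S W] (hW : IsLocallyProjective S W) (F : Finset W) :
    ∃ (T : Finset W) (f : W → W →ₗ[S] S), ∀ x ∈ F, ∑ w ∈ T, f w x • w = x := by
  classical
  let e : ULift.{u} W ≃ₗ[S] W := ULift.moduleEquiv
  let π : (W →₀ S) →ₗ[S] ULift.{u} W := e.symm.toLinearMap ∘ₗ Finsupp.linearCombination S id
  have hπ : Function.Surjective π :=
    e.symm.surjective.comp (Finsupp.linearCombination_id_surjective S W)
  obtain ⟨g, hg⟩ := hW (W →₀ S) (ULift.{u} W) π hπ e.symm.toLinearMap (Submodule.span S F)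
    (Submodule.fg_span F.finite_toSet)
  refine ⟨F.biUnion fun x => (g x).support, fun w => Finsupp.lapply w ∘ₗ g, fun x hx => ?_⟩
  have hgx : Finsupp.linearCombination S id (g x) = x :=
    e.symm.injective (hg x (Submodule.subset_span hx))
  rw [Finsupp.linearCombination_apply, Finsupp.sum_of_support_subset _
    (Finset.subset_biUnion_of_mem (fun x => (g x).support) hx) _ fun w _ => zero_smul S w] at hgx
  exact hgx

theorem exists_mem_eqOn_of_dense_induced {X U Y : Type*} {φ : X → U → Y} {s : Set X}
    (hs : @Dense X (TopologicalSpace.induced φ (@Pi.topologicalSpace U (fun _ => Y) fun _ => ⊥)) s)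
    (x : X) {F : Set U} (hF : F.Finite) : ∃ y ∈ s, Set.EqOn (φ y) (φ x) F := by
  let _ : TopologicalSpace Y := ⊥
  have _ : DiscreteTopology Y := ⟨rfl⟩
  let _ : TopologicalSpace X := TopologicalSpace.induced φ Pi.topologicalSpace
  have hO : IsOpen (φ ⁻¹' F.pi fun u => {φ x u}) :=
    (isOpen_set_pi hF fun _ _ => isOpen_discrete _).preimage continuous_induced_dom
  obtain ⟨y, hyO, hys⟩ := hs.inter_open_nonempty _ hO ⟨x, fun _ _ => rfl⟩
  exact ⟨y, hys, hyO⟩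

namespace MeasuringLeftPairing

variable {R A C : Type*} [Ring R] [NonUnitalRing A] [Module R A] [Module Rᵐᵒᵖ A] [IsRRing R A]
  [AddCommGroup C] [Module R C] [Module Rᵐᵒᵖ C] [SMulCommClass R Rᵐᵒᵖ C] [RCoring R C]
  {P : MeasuringLeftPairing R A C} {M : Type*} [AddCommGroup M] [Module Rᵐᵒᵖ M]

/-- Every finite subset of `C` has a dual basis whose functionals come from `A`. The functionals
are indexed by `C` itself, of which only the finite subset `T` matters. -/
def HasLocalDualBases (P : MeasuringLeftPairing R A C) : Prop :=
  ∀ F : Finset C, ∃ (T : Finset C) (a : C → A), ∀ c ∈ F, ∑ w ∈ T, P.κ (a w) c • w = c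

theorem IsDense.hasLocalDualBases (hP : P.IsDense) (hC : IsLocallyProjective R C) :
    P.HasLocalDualBases := by
  intro F
  obtain ⟨T, f, hf⟩ := hC.exists_localDualBasis F
  have happrox (w : C) : ∃ a, ∀ c ∈ F, P.κ a c = f w c := by
    obtain ⟨_, ⟨a, rfl⟩, ha⟩ :=
      exists_mem_eqOn_of_dense_induced hP (f w : LeftDual R C) F.finite_toSet
    exact ⟨a, ha⟩
  choose a ha using happrox
  exact ⟨T, a, fun c hc => by simp only [ha _ c hc, hf c hc]⟩

theorem HasLocalDualBases.exists_sum_eval_tmul (hP : P.HasLocalDualBases) (t : RTensor R M C) :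
    ∃ (T : Finset C) (a : C → A), ∑ w ∈ T, RTensor.tmul R ((P.κ (a w)).eval t) w = t := by
  obtain ⟨F, hF⟩ := LeftDual.exists_finset_sum_eval_tmul t
  obtain ⟨T, a, ha⟩ := hP F
  exact ⟨T, a, hF T (fun w => P.κ (a w)) ha⟩

theorem HasLocalDualBases.tensor_ext (hP : P.HasLocalDualBases) {s t : RTensor R M C}
    (h : ∀ a, (P.κ a).eval s = (P.κ a).eval t) : s = t := by
  obtain ⟨T, a, hst⟩ := hP.exists_sum_eval_tmul (s - t)
  rw [← sub_eq_zero, ← hst]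
  simp only [map_sub, h, sub_self, RTensor.zero_tmul, Finset.sum_const_zero]

theorem HasLocalDualBases.tensor_ext₂ (hP : P.HasLocalDualBases)
    {s t : RTensor R M (RTensor R C C)}
    (h : ∀ a a', ((P.κ a).tensor (P.κ a')).eval s = ((P.κ a).tensor (P.κ a')).eval t) : s = t := by
  obtain ⟨s, rfl⟩ := RTensor.assoc_surjective s
  obtain ⟨t, rfl⟩ := RTensor.assoc_surjective t
  simp only [LeftDual.tensor_eval_assoc] at h
  exact congrArg _ (hP.tensor_ext fun a => hP.tensor_ext (h a))

theorem HasLocalDualBases.eval_mem_closure (hP : P.HasLocalDualBases) (f : LeftDual R C)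
    (t : RTensor R M C) : f.eval t ∈ AddSubgroup.closure (Set.range fun a => (P.κ a).eval t) := by
  obtain ⟨T, a, ht⟩ := hP.exists_sum_eval_tmul t
  have hf : f.eval t = ∑ w ∈ T, (P.κ (op (f w) • a w)).eval t := by
    conv_lhs => rw [← ht]
    simp only [map_sum, LeftDual.eval_tmul, LeftDual.op_smul_eval, BimodMap.map_smul_right]
  rw [hf]
  exact AddSubgroup.sum_mem _ fun w _ => AddSubgroup.subset_closure ⟨_, rfl⟩

end MeasuringLeftPairing

namespace MeasuringRightPairing

variable {R B D : Type*} [Ring R] [NonUnitalRing B] [Module R B] [Module Rᵐᵒᵖ B] [IsRRing R B]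
  [AddCommGroup D] [Module R D] [Module Rᵐᵒᵖ D] [SMulCommClass R Rᵐᵒᵖ D] [RCoring R D]
  {Q : MeasuringRightPairing R B D} {M : Type*} [AddCommGroup M] [Module R M]

/-- Every finite subset of `D` has a dual basis whose functionals come from `B`. The functionals
are indexed by `D` itself, of which only the finite subset `T` matters. -/
def HasLocalDualBases (Q : MeasuringRightPairing R B D) : Prop :=
  ∀ F : Finset D, ∃ (T : Finset D) (b : D → B), ∀ d ∈ F, ∑ w ∈ T, op (Q.κ (b w) d) • w = d

theorem IsDense.hasLocalDualBases (hQ : Q.IsDense) (hD : IsLocallyProjective Rᵐᵒᵖ D) :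
    Q.HasLocalDualBases := by
  intro F
  obtain ⟨T, f, hf⟩ := hD.exists_localDualBasis F
  let unopHom : Rᵐᵒᵖ →ₗ[Rᵐᵒᵖ] R := (opLinearEquiv Rᵐᵒᵖ).symm.toLinearMap
  have happrox (w : D) : ∃ b, ∀ d ∈ F, Q.κ b d = unop (f w d) := by
    obtain ⟨_, ⟨b, rfl⟩, hb⟩ :=
      exists_mem_eqOn_of_dense_induced hQ (unopHom ∘ₗ f w : RightDual R D) F.finite_toSet
    exact ⟨b, hb⟩
  choose b hb using happrox
  exact ⟨T, b, fun d hd => by simp only [hb _ d hd, op_unop, hf d hd]⟩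

theorem HasLocalDualBases.exists_sum_tmul_eval (hQ : Q.HasLocalDualBases) (t : RTensor R D M) :
    ∃ (T : Finset D) (b : D → B), ∑ w ∈ T, RTensor.tmul R w ((Q.κ (b w)).eval t) = t := by
  obtain ⟨F, hF⟩ := RightDual.exists_finset_sum_tmul_eval t
  obtain ⟨T, b, hb⟩ := hQ F
  exact ⟨T, b, hF T (fun w => Q.κ (b w)) hb⟩

theorem HasLocalDualBases.tensor_ext (hQ : Q.HasLocalDualBases) {s t : RTensor R D M}
    (h : ∀ b, (Q.κ b).eval s = (Q.κ b).eval t) : s = t := by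
  obtain ⟨T, b, hst⟩ := hQ.exists_sum_tmul_eval (s - t)
  rw [← sub_eq_zero, ← hst]
  simp only [map_sub, h, sub_self, RTensor.tmul_zero, Finset.sum_const_zero]

theorem HasLocalDualBases.eval_mem_closure (hQ : Q.HasLocalDualBases) (f : RightDual R D)
    (t : RTensor R D M) : f.eval t ∈ AddSubgroup.closure (Set.range fun b => (Q.κ b).eval t) := by
  obtain ⟨T, b, ht⟩ := hQ.exists_sum_tmul_eval t
  have hf : f.eval t = ∑ w ∈ T, (Q.κ (f w • b w)).eval t := by
    conv_lhs => rw [← ht]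
    simp only [map_sum, RightDual.eval_tmul, RightDual.smul_eval, BimodMap.map_smul_left]
  rw [hf]
  exact AddSubgroup.sum_mem _ fun w _ => AddSubgroup.subset_closure ⟨_, rfl⟩

end MeasuringRightPairing

/-! ### Coactions -/

section coactions

variable {R M C : Type*} [Ring R] [AddCommGroup M] [AddCommGroup C] [Module R C] [Module Rᵐᵒᵖ C]
  [SMulCommClass R Rᵐᵒᵖ C] [RCoring R C]

/-- Coassociativity of a right coaction `ρ : M → M ⊗_R C`. No counit condition is imposed. -/
def IsRightCoaction [Module Rᵐᵒᵖ M] (ρ : M →ₗ[Rᵐᵒᵖ] RTensor R M C) : Prop :=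
  ∀ m, RTensor.assoc R M C C (RTensor.map ρ LinearMap.id (ρ m)) =
    RTensor.map LinearMap.id (RCoring.comul (R := R) (C := C)).left (ρ m)

/-- Coassociativity of a left coaction `ρ : M → C ⊗_R M`. No counit condition is imposed. -/
def IsLeftCoaction [Module R M] (ρ : M →ₗ[R] RTensor R C M) : Prop :=
  ∀ m, RTensor.assoc R C C M
      (RTensor.map (RCoring.comul (R := R) (C := C)).right LinearMap.id (ρ m)) =
    RTensor.map LinearMap.id ρ (ρ m)

end coactions

namespace MeasuringLeftPairing.HasLocalDualBases

variable {R A C : Type*} [Ring R] [NonUnitalRing A] [Module R A] [Module Rᵐᵒᵖ A] [IsRRing R A]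
  [AddCommGroup C] [Module R C] [Module Rᵐᵒᵖ C] [SMulCommClass R Rᵐᵒᵖ C] [RCoring R C]
  {P : MeasuringLeftPairing R A C} {M : Type*} [AddCommGroup M] [Module Rᵐᵒᵖ M]
  {ρ : M →ₗ[Rᵐᵒᵖ] RTensor R M C}

theorem isRightCoaction (hP : P.HasLocalDualBases)
    (h : ∀ m a a', (P.κ a').eval (ρ ((P.κ a).eval (ρ m))) = (P.κ (a * a')).eval (ρ m)) :
    IsRightCoaction ρ := fun m => hP.tensor_ext₂ fun a a' => by
  rw [LeftDual.tensor_eval_assoc, LeftDual.eval_map, LeftDual.tensor_eval_map_comul, h, P.map_mul]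

theorem injective_iff_counit_eval (hP : P.HasLocalDualBases) (hρ : IsRightCoaction ρ) :
    Function.Injective ρ ↔ ∀ m, (LeftDual.counit R C).eval (ρ m) = m := by
  refine ⟨fun hinj m => hinj (hP.tensor_ext fun a => ?_), Function.LeftInverse.injective⟩
  rw [LeftDual.eval_eval ρ hρ, LeftDual.counit_mul]

theorem injective_eval_comp_iff (hP : P.HasLocalDualBases) :
    (Function.Injective fun m a => (P.κ a).eval (ρ m)) ↔ Function.Injective ρ := by
  have heval : Function.Injective fun (t : RTensor R M C) a => (P.κ a).eval t :=
    fun _ _ h => hP.tensor_ext (congrFun h)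
  exact heval.of_comp_iff ρ

theorem closure_eq_top_iff_counit_eval (hP : P.HasLocalDualBases) (hρ : IsRightCoaction ρ) :
    AddSubgroup.closure {x | ∃ m a, x = (P.κ a).eval (ρ m)} = ⊤ ↔
      ∀ m, (LeftDual.counit R C).eval (ρ m) = m := by
  refine ⟨fun htop => ?_, fun h => top_le_iff.1 fun m _ => ?_⟩
  · have heq : (LeftDual.counit R C).eval.comp ρ.toAddMonoidHom = AddMonoidHom.id M := by
      refine AddMonoidHom.eq_of_eqOn_dense htop ?_
      rintro _ ⟨m, a, rfl⟩
      exact (LeftDual.eval_eval ρ hρ (P.κ a) (LeftDual.counit R C) m).trans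
        (by rw [LeftDual.mul_counit, AddMonoidHom.id_apply])
    exact DFunLike.congr_fun heq
  · have hm := hP.eval_mem_closure (LeftDual.counit R C) (ρ m)
    rw [h m] at hm
    refine AddSubgroup.closure_mono ?_ hm
    rintro _ ⟨a, rfl⟩
    exact ⟨m, a, rfl⟩

end MeasuringLeftPairing.HasLocalDualBases

namespace MeasuringRightPairing.HasLocalDualBases

variable {R B D : Type*} [Ring R] [NonUnitalRing B] [Module R B] [Module Rᵐᵒᵖ B] [IsRRing R B]
  [AddCommGroup D] [Module R D] [Module Rᵐᵒᵖ D] [SMulCommClass R Rᵐᵒᵖ D] [RCoring R D]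
  {Q : MeasuringRightPairing R B D} {M : Type*} [AddCommGroup M] [Module R M]
  {ρ : M →ₗ[R] RTensor R D M}

theorem isLeftCoaction (hQ : Q.HasLocalDualBases)
    (h : ∀ m b b', (Q.κ b).eval (ρ ((Q.κ b').eval (ρ m))) = (Q.κ (b * b')).eval (ρ m)) :
    IsLeftCoaction ρ := fun m => hQ.tensor_ext fun b' => hQ.tensor_ext fun b => by
  rw [RightDual.eval_eval_assoc, RightDual.tensor_eval_map_comul, RightDual.eval_map, h, Q.map_mul]

theorem injective_iff_counit_eval (hQ : Q.HasLocalDualBases) (hρ : IsLeftCoaction ρ) :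
    Function.Injective ρ ↔ ∀ m, (RightDual.counit R D).eval (ρ m) = m := by
  refine ⟨fun hinj m => hinj (hQ.tensor_ext fun b => ?_), Function.LeftInverse.injective⟩
  rw [RightDual.eval_eval ρ hρ, RightDual.mul_counit]

theorem injective_eval_comp_iff (hQ : Q.HasLocalDualBases) :
    (Function.Injective fun m b => (Q.κ b).eval (ρ m)) ↔ Function.Injective ρ := by
  have heval : Function.Injective fun (t : RTensor R D M) b => (Q.κ b).eval t :=
    fun _ _ h => hQ.tensor_ext (congrFun h)
  exact heval.of_comp_iff ρ

theorem closure_eq_top_iff_counit_eval (hQ : Q.HasLocalDualBases) (hρ : IsLeftCoaction ρ) :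
    AddSubgroup.closure {x | ∃ b m, x = (Q.κ b).eval (ρ m)} = ⊤ ↔
      ∀ m, (RightDual.counit R D).eval (ρ m) = m := by
  refine ⟨fun htop => ?_, fun h => top_le_iff.1 fun m _ => ?_⟩
  · have heq : (RightDual.counit R D).eval.comp ρ.toAddMonoidHom = AddMonoidHom.id M := by
      refine AddMonoidHom.eq_of_eqOn_dense htop ?_
      rintro _ ⟨b, m, rfl⟩
      exact (RightDual.eval_eval ρ hρ (RightDual.counit R D) (Q.κ b) m).trans
        (by rw [RightDual.counit_mul, AddMonoidHom.id_apply])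
    exact DFunLike.congr_fun heq
  · have hm := hQ.eval_mem_closure (RightDual.counit R D) (ρ m)
    rw [h m] at hm
    refine AddSubgroup.closure_mono ?_ hm
    rintro _ ⟨b, rfl⟩
    exact ⟨b, m, rfl⟩

end MeasuringRightPairing.HasLocalDualBases

/-! ### Bicomodules as birational bimodules -/

section bimodules

variable {R A B C D : Type*} [Ring R]
  [NonUnitalRing A] [Module R A] [Module Rᵐᵒᵖ A] [NonUnitalRing B] [Module R B] [Module Rᵐᵒᵖ B]
  [AddCommGroup C] [Module R C] [Module Rᵐᵒᵖ C] [SMulCommClass R Rᵐᵒᵖ C] [RCoring R C]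
  [AddCommGroup D] [Module R D] [Module Rᵐᵒᵖ D] [SMulCommClass R Rᵐᵒᵖ D] [RCoring R D]

theorem RingBimodule.ext_of_heq {M N : RingBimodule.{v} R B A}
    (h : M.toRBimodule = N.toRBimodule) (hract : M.ract ≍ N.ract) (hlact : M.lact ≍ N.lact) :
    M = N := by
  cases M
  cases N
  cases h
  cases hract
  cases hlact
  rfl

theorem RingBimodule.exists_rcoact [IsRRing R A] {P : MeasuringLeftPairing R A C}
    {M : RingBimodule.{v} R B A} (hP : P.HasLocalDualBases) (hM : M.rightRat P = Set.univ) :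
    ∃ ρ : BimodMap R M.carrier (RTensor R M.carrier C),
      ∀ m a, (P.κ a).eval (ρ m) = M.ract m a := by
  choose ρ hρ using Set.eq_univ_iff_forall.1 hM
  have hadd (m m' : M.carrier) : ρ (m + m') = ρ m + ρ m' := hP.tensor_ext fun a => by
    rw [map_add, ← hρ, ← hρ, ← hρ, map_add, AddMonoidHom.add_apply]
  have hsmul (r : R) (m : M.carrier) : ρ (r • m) = r • ρ m := hP.tensor_ext fun a => by
    rw [LeftDual.eval_smul, ← hρ, ← hρ, M.ract_smul]
  have hop (r : R) (m : M.carrier) : ρ (op r • m) = op r • ρ m := hP.tensor_ext fun a => by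
    rw [LeftDual.eval_op_smul, ← P.κ.map_smul_left, ← hρ, ← hρ, M.ract_balanced]
  exact ⟨⟨⟨⟨ρ, hadd⟩, hsmul⟩, fun r m => hop r.unop m⟩, fun m a => (hρ m a).symm⟩

theorem RingBimodule.exists_lcoact [IsRRing R B] {Q : MeasuringRightPairing R B D}
    {M : RingBimodule.{v} R B A} (hQ : Q.HasLocalDualBases) (hM : M.leftRat Q = Set.univ) :
    ∃ l : BimodMap R M.carrier (RTensor R D M.carrier),
      ∀ m b, (Q.κ b).eval (l m) = M.lact b m := by
  choose l hl using Set.eq_univ_iff_forall.1 hM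
  have hadd (m m' : M.carrier) : l (m + m') = l m + l m' := hQ.tensor_ext fun b => by
    rw [map_add, ← hl, ← hl, ← hl, map_add]
  have hsmul (r : R) (m : M.carrier) : l (r • m) = r • l m := hQ.tensor_ext fun b => by
    rw [RightDual.eval_smul, ← Q.κ.map_smul_right, ← hl, ← hl, M.lact_balanced]
  have hop (r : R) (m : M.carrier) : l (op r • m) = op r • l m := hQ.tensor_ext fun b => by
    rw [RightDual.eval_op_smul, ← hl, ← hl, M.lact_op_smul]
  exact ⟨⟨⟨⟨l, hadd⟩, hsmul⟩, fun r m => hop r.unop m⟩, fun m b => (hl m b).symm⟩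

variable [IsRRing R A] [IsRRing R B] {P : MeasuringLeftPairing R A C}
  {Q : MeasuringRightPairing R B D}

theorem RingBimodule.IsBirational.exists_toRingBimodule_eq {M : RingBimodule.{v} R B A}
    (hM : RingBimodule.IsBirational P Q M) (hP : P.HasLocalDualBases)
    (hQ : Q.HasLocalDualBases) :
    ∃ X : Bicomodule.{v} R D C, X.toRingBimodule P Q = M := by
  obtain ⟨hleft, hright⟩ := inf_eq_top_iff.1 hM
  obtain ⟨ρ, hρ⟩ := M.exists_rcoact hP hright
  obtain ⟨l, hl⟩ := M.exists_lcoact hQ hleft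
  let X : Bicomodule.{v} R D C :=
    { toRBimodule := M.toRBimodule
      rcoact := ρ
      rcoassoc := hP.isRightCoaction (ρ := ρ.right) fun m a a' => by
        simp only [BimodMap.right_apply, hρ, M.ract_mul]
      lcoact := l
      lcoassoc := hQ.isLeftCoaction (ρ := l.left) fun m b b' => by
        simp only [BimodMap.left_apply, hl, M.lact_mul]
      compat := fun m => hQ.tensor_ext fun b => hP.tensor_ext fun a => by
        rw [LeftDual.eval_rightDual_eval_assoc, LeftDual.eval_map, RightDual.eval_map,
          BimodMap.right_apply, BimodMap.left_apply, hl, hρ, hl, hρ, M.lact_ract] }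
  exact ⟨X, RingBimodule.ext_of_heq rfl
    (heq_of_eq (AddMonoidHom.ext fun m => AddMonoidHom.ext fun a => hρ m a))
    (heq_of_eq (AddMonoidHom.ext fun b => AddMonoidHom.ext fun m => hl m b))⟩

namespace Bicomodule

theorem toRingBimodule_isBirational (X : Bicomodule.{v} R D C) :
    RingBimodule.IsBirational P Q (X.toRingBimodule P Q) :=
  Set.eq_univ_of_forall fun m => ⟨⟨X.lcoact m, fun _ => rfl⟩, ⟨X.rcoact m, fun _ => rfl⟩⟩

theorem toRingBimodule_isFaithful_iff (hP : P.HasLocalDualBases) (hQ : Q.HasLocalDualBases)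
    (X : Bicomodule.{v} R D C) :
    RingBimodule.IsFaithful R B A (X.toRingBimodule P Q) ↔ IsCounital R D C X :=
  and_congr (hP.injective_eval_comp_iff (ρ := X.rcoact.right))
    (hQ.injective_eval_comp_iff (ρ := X.lcoact.left))

theorem toRingBimodule_isUnital_iff (hP : P.HasLocalDualBases) (hQ : Q.HasLocalDualBases)
    (X : Bicomodule.{v} R D C) :
    RingBimodule.IsUnital R B A (X.toRingBimodule P Q) ↔ IsCounital R D C X := by
  have hr : IsRightCoaction X.rcoact.right := X.rcoassoc
  have hl : IsLeftCoaction X.lcoact.left := X.lcoassoc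
  exact and_congr
    ((hP.closure_eq_top_iff_counit_eval hr).trans (hP.injective_iff_counit_eval hr).symm)
    ((hQ.closure_eq_top_iff_counit_eval hl).trans (hQ.injective_iff_counit_eval hl).symm)

theorem toRingBimodule_injective (hP : P.HasLocalDualBases) (hQ : Q.HasLocalDualBases) :
    Function.Injective (toRingBimodule.{v} P Q) := by
  rintro ⟨V, ρ, _, l, _, _⟩ ⟨V', ρ', _, l', _, _⟩ h
  obtain rfl : V = V' := congrArg RingBimodule.toRBimodule h
  obtain ⟨-, hract, hlact⟩ := RingBimodule.mk.inj h
  obtain rfl : ρ = ρ' := BimodMap.ext fun m => hP.tensor_ext fun a =>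
    DFunLike.congr_fun (DFunLike.congr_fun (eq_of_heq hract) m) a
  obtain rfl : l = l' := BimodMap.ext fun m => hQ.tensor_ext fun b =>
    DFunLike.congr_fun (DFunLike.congr_fun (eq_of_heq hlact) b) m
  rfl

end Bicomodule

theorem RingBimodule.isFaithfulBirational_eq_isUnitalBirational (hP : P.HasLocalDualBases)
    (hQ : Q.HasLocalDualBases) :
    RingBimodule.IsFaithfulBirational.{v} P Q = RingBimodule.IsUnitalBirational.{v} P Q := by
  ext M
  refine and_congr_left fun hM => ?_
  obtain ⟨X, rfl⟩ := hM.exists_toRingBimodule_eq hP hQ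
  exact (X.toRingBimodule_isFaithful_iff hP hQ).trans (X.toRingBimodule_isUnital_iff hP hQ).symm

/-! ### The isomorphism of categories -/

namespace Bicomodule

theorem toRingBimoduleFunctor_full (hP : P.HasLocalDualBases) (hQ : Q.HasLocalDualBases) :
    (toRingBimoduleFunctor.{v} P Q).Full where
  map_surjective {X Y} f := by
    obtain ⟨f, hract, hlact⟩ := f
    refine ⟨⟨f, fun m => hP.tensor_ext fun a => ?_, fun m => hQ.tensor_ext fun b => ?_⟩, rfl⟩
    · exact (hract m a).symm.trans (LeftDual.eval_map (P.κ a) f.right (X.rcoact m)).symm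
    · exact (hlact b m).symm.trans (RightDual.eval_map (Q.κ b) f.left (X.lcoact m)).symm

instance toRingBimoduleFunctor_faithful : (toRingBimoduleFunctor.{v} P Q).Faithful where
  map_injective h := Hom.ext (congrArg RingBimodule.Hom.toMap h)

/-- The functor of the theorem: `toRingBimoduleFunctor` on counital bicomodules, corestricted to
faithful birational bimodules. -/
def toFaithfulBirational (hP : P.HasLocalDualBases) (hQ : Q.HasLocalDualBases) :
    (IsCounital.{v} R D C).FullSubcategory ⥤
      (RingBimodule.IsFaithfulBirational.{v} P Q).FullSubcategory :=
  (RingBimodule.IsFaithfulBirational P Q).lift ((IsCounital R D C).ι ⋙ toRingBimoduleFunctor P Q)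
    fun X => ⟨(X.obj.toRingBimodule_isFaithful_iff hP hQ).2 X.property,
      X.obj.toRingBimodule_isBirational⟩

theorem toFaithfulBirational_bijective_obj (hP : P.HasLocalDualBases)
    (hQ : Q.HasLocalDualBases) :
    Function.Bijective (toFaithfulBirational.{v} hP hQ).obj := by
  refine ⟨fun X Y h => ?_, ?_⟩
  · exact ObjectProperty.FullSubcategory.ext
      (toRingBimodule_injective hP hQ (congrArg ObjectProperty.FullSubcategory.obj h))
  · rintro ⟨M, hfaithful, hbirational⟩
    obtain ⟨X, rfl⟩ := hbirational.exists_toRingBimodule_eq hP hQ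
    exact ⟨⟨X, (X.toRingBimodule_isFaithful_iff hP hQ).1 hfaithful⟩, rfl⟩

theorem toFaithfulBirational_isIso (hP : P.HasLocalDualBases) (hQ : Q.HasLocalDualBases) :
    (toFaithfulBirational.{v} hP hQ).IsIso := by
  have := toRingBimoduleFunctor_full.{v} hP hQ
  let e := ObjectProperty.liftCompιIso (RingBimodule.IsFaithfulBirational P Q)
    ((IsCounital.{v} R D C).ι ⋙ toRingBimoduleFunctor P Q)
    fun X => ((toFaithfulBirational hP hQ).obj X).property
  exact
    { faithful := Functor.Faithful.of_comp_iso e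
      full := Functor.Full.of_comp_faithful_iso e
      bijective_obj := toFaithfulBirational_bijective_obj hP hQ }

theorem exists_isoCat_comp_ι_eq (hP : P.HasLocalDualBases) (hQ : Q.HasLocalDualBases) :
    ∃ e : IsoCat (IsCounital.{v} R D C).FullSubcategory
        (RingBimodule.IsFaithfulBirational.{v} P Q).FullSubcategory,
      e.functor ⋙ (RingBimodule.IsFaithfulBirational P Q).ι =
        (IsCounital R D C).ι ⋙ toRingBimoduleFunctor P Q := by
  have := toFaithfulBirational_isIso.{v} hP hQ
  exact ⟨(toFaithfulBirational hP hQ).asIsomorphism, rfl⟩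

end Bicomodule

end bimodules

section evaluationPairings

variable (R C : Type*) [Ring R] [AddCommGroup C] [Module R C] [Module Rᵐᵒᵖ C]
  [SMulCommClass R Rᵐᵒᵖ C] [RCoring R C]

theorem LeftDual.pairing_isDense : (LeftDual.pairing R C).IsDense :=
  @Function.Surjective.denseRange _ (LeftDual.finiteTopology R C) _ _ fun f => ⟨f, rfl⟩

theorem RightDual.pairing_isDense : (RightDual.pairing R C).IsDense :=
  @Function.Surjective.denseRange _ (RightDual.finiteTopology R C) _ _ fun f => ⟨f, rfl⟩

end evaluationPairings

theorem mainTheorem9 {R A B C D : Type u} [Ring R]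
    [NonUnitalRing A] [Module R A] [Module Rᵐᵒᵖ A] [IsRRing R A]
    [NonUnitalRing B] [Module R B] [Module Rᵐᵒᵖ B] [IsRRing R B]
    [AddCommGroup C] [Module R C] [Module Rᵐᵒᵖ C] [SMulCommClass R Rᵐᵒᵖ C] [RCoring R C]
    [AddCommGroup D] [Module R D] [Module Rᵐᵒᵖ D] [SMulCommClass R Rᵐᵒᵖ D] [RCoring R D]
    (P : MeasuringLeftPairing R A C) (Q : MeasuringRightPairing R B D)
    (hC : IsLocallyProjective R C) (hD : IsLocallyProjective Rᵐᵒᵖ D)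
    (hP : P.IsDense) (hQ : Q.IsDense) :
    (∃ e : IsoCat (Bicomodule.IsCounital.{v} R D C).FullSubcategory
        (RingBimodule.IsFaithfulBirational.{v} P Q).FullSubcategory,
      e.functor ⋙ (RingBimodule.IsFaithfulBirational P Q).ι =
        (Bicomodule.IsCounital R D C).ι ⋙ Bicomodule.toRingBimoduleFunctor P Q) ∧
    RingBimodule.IsFaithfulBirational.{v} P Q = RingBimodule.IsUnitalBirational.{v} P Q ∧
    (∃ e : IsoCat (Bicomodule.IsCounital.{v} R D C).FullSubcategory
        (RingBimodule.IsFaithfulBirational.{v} (LeftDual.pairing R C)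
          (RightDual.pairing R D)).FullSubcategory,
      e.functor ⋙ (RingBimodule.IsFaithfulBirational (LeftDual.pairing R C)
          (RightDual.pairing R D)).ι =
        (Bicomodule.IsCounital R D C).ι ⋙
          Bicomodule.toRingBimoduleFunctor (LeftDual.pairing R C) (RightDual.pairing R D)) ∧
    RingBimodule.IsFaithfulBirational.{v} (LeftDual.pairing R C) (RightDual.pairing R D) =
      RingBimodule.IsUnitalBirational.{v} (LeftDual.pairing R C) (RightDual.pairing R D) := by
  have hP' := hP.hasLocalDualBases hC
  have hQ' := hQ.hasLocalDualBases hD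
  have hC' := (LeftDual.pairing_isDense R C).hasLocalDualBases hC
  have hD' := (RightDual.pairing_isDense R D).hasLocalDualBases hD
  exact ⟨Bicomodule.exists_isoCat_comp_ι_eq hP' hQ',
    RingBimodule.isFaithfulBirational_eq_isUnitalBirational hP' hQ',
    Bicomodule.exists_isoCat_comp_ι_eq hC' hD',
    RingBimodule.isFaithfulBirational_eq_isUnitalBirational hC' hD'⟩
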